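/- Let $b>0$, let $q:[-b,b]\to\mathbb{C}$ be continuous, and let $f\in C^2[-b,b]$ be a complex-valued solution of $f''-qf=0$ on $[-b,b]$ with $f(0)=1$ and $f(x)\neq 0$ for all $x\in[0,b]$. For $K\in C^1([-b,b]\times[-b,b])$ (complex valued) put $$T_Ku(x)=u(x)+\int_{-x}^{x}K(x,t)u(t)\,dt,\qquad x\in[-b,b].$$ Call $K$ a transmutation kernel (for $q$ and $f$) if $T_Ku\in C^2[-b,b]$ and $\left(-\frac{d^2}{dx^2}+q(x)\right)T_K[u]=T_K[-u'']$ on $[-b,b]$ for every $u\in C^2[-b,b]$, and $T_K[1]=f$. For $x\in[0,b]$ let $X^{(0)}\equiv\widetilde X^{(0)}\equiv 1$ and, for $n\ge 1$, $$X^{(n)}(x)=n\int_0^xX^{(n-1)}(s)\left(f^2(s)\right)^{(-1)^n}ds,\qquad \widetilde X^{(n)}(x)=n\int_0^x\widetilde X^{(n-1)}(s)\left(f^2(s)\right)^{(-1)^{n-1}}ds,$$ and let $\varphi_k=fX^{(k)}$ for odd $k$ and $\varphi_k=f\widetilde X^{(k)}$ for even $k$. Let $P_n(x)=\sum_{k=0}^n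 l_{k,n}x^k$ be the Legendre polynomial of degree $n$ and $p_{j,k}=\int_{-1}^1P_j(y)y^k\,dy$. For $x\in(0,b]$ define recursively $$\beta_0(x)=\frac{f(x)-1}{2},\qquad \beta_1(x)=\frac32\left(\frac{\varphi_1(x)}{x}-1\right),\qquad \beta_k(x)=\frac1{p_{k,k}}\Bigl(\frac{\varphi_k(x)}{x^k}-1-\sum_{\substack{0\le j\le k-2\\ j\equiv k\ (\mathrm{mod}\ 2)}}p_{j,k}\,\beta_j(x)\Bigr)\quad(k\ge 2).$$ Theorem. A transmutation kernel exists, and every transmutation kernel $K$ satisfies, for each $x\in(0,b]$, $$K(x,t)=\sum_{j=0}^\infty\frac{\beta_j(x)}{x}P_j\left(\frac tx\right),$$ where the series converges uniformly with respect to $t\in[-x,x]$. Moreover, for all $n\ge 0$ and $x\in(0,b]$, $$\beta_n(x)=\frac{2n+1}{2}\Bigl(\sum_{k=0}^n\frac{l_{k,n}\,\varphi_k(x)}{x^k}-1\Bigr).$$ -/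

import Mathlib

namespace Transmutation

/-- The Legendre polynomial `P_n` (Rodrigues' formula). Its coefficient of `x ^ k` is
`(legendre n).coeff k`. -/
noncomputable def legendre (n : ℕ) : Polynomial ℝ :=
  Polynomial.C (1 / (2 ^ n * (n.factorial : ℝ))) *
    Polynomial.derivative^[n] ((Polynomial.X ^ 2 - 1) ^ n)

/-- `p_{j,k} = ∫_{-1}^{1} P_j(y) y^k dy`. -/
noncomputable def legendreMoment (j k : ℕ) : ℝ :=
  ∫ y in (-1 : ℝ)..1, (legendre j).eval y * y ^ k

/-- `f` is a twice continuously differentiable solution of `f'' = q f` on `[-b, b]`. -/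
structure IsSolution (b : ℝ) (q f : ℝ → ℂ) : Prop where
  contDiffOn : ContDiffOn ℝ 2 f (Set.Icc (-b) b)
  ode : ∀ x ∈ Set.Icc (-b) b, iteratedDerivWithin 2 f (Set.Icc (-b) b) x = q x * f x

/-- The recursive integrals `X^{(n)}`. -/
noncomputable def recX (f : ℝ → ℂ) : ℕ → ℝ → ℂ
  | 0 => fun _ => 1
  | n + 1 => fun x =>
      ((n + 1 : ℕ) : ℂ) * ∫ s in (0 : ℝ)..x, recX f n s * (f s ^ 2) ^ ((-1 : ℤ) ^ (n + 1))

/-- The recursive integrals with the opposite parity of the exponents (written `X` with a tilde). -/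
noncomputable def recXTilde (f : ℝ → ℂ) : ℕ → ℝ → ℂ
  | 0 => fun _ => 1
  | n + 1 => fun x =>
      ((n + 1 : ℕ) : ℂ) * ∫ s in (0 : ℝ)..x, recXTilde f n s * (f s ^ 2) ^ ((-1 : ℤ) ^ n)

/-- The formal powers `φ_k` associated with `f`. -/
noncomputable def formalPower (f : ℝ → ℂ) (k : ℕ) (x : ℝ) : ℂ :=
  if Odd k then f x * recX f k x else f x * recXTilde f k x

/-- The Volterra operator `T u (x) = u(x) + ∫_{-x}^{x} K(x,t) u(t) dt` (oriented integral). -/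
noncomputable def volterraOp (K : ℝ → ℝ → ℂ) (u : ℝ → ℂ) (x : ℝ) : ℂ :=
  u x + ∫ t in (-x)..x, K x t * u t

/-- `K` is a transmutation kernel for `-d²/dx² + q` on `[-b, b]`, normalized by `T[1] = f`:
it is `C¹` on the square `[-b, b] × [-b, b]`, its Volterra operator `T` maps `C²[-b, b]` to itself
and intertwines, `(-d²/dx² + q) T[u] = T[-u'']`, and `T[1] = f`. -/
structure IsTransmutationKernel (b : ℝ) (q f : ℝ → ℂ) (K : ℝ → ℝ → ℂ) : Prop where
  contDiffOn : ContDiffOn ℝ 1 (Function.uncurry K) (Set.Icc (-b) b ×ˢ Set.Icc (-b) b)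
  map_contDiffOn : ∀ u : ℝ → ℂ, ContDiffOn ℝ 2 u (Set.Icc (-b) b) →
    ContDiffOn ℝ 2 (volterraOp K u) (Set.Icc (-b) b)
  intertwine : ∀ u : ℝ → ℂ, ContDiffOn ℝ 2 u (Set.Icc (-b) b) → ∀ x ∈ Set.Icc (-b) b,
    -iteratedDerivWithin 2 (volterraOp K u) (Set.Icc (-b) b) x + q x * volterraOp K u x =
      volterraOp K (fun t => -iteratedDerivWithin 2 u (Set.Icc (-b) b) t) x
  map_one : ∀ x ∈ Set.Icc (-b) b, volterraOp K (fun _ => 1) x = f x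

/-- The functions `β_k`, by their recursive definition; the sum runs over the `j ≤ k - 2` that have
the same parity as `k`. -/
noncomputable def beta (f : ℝ → ℂ) : ℕ → ℝ → ℂ
  | 0 => fun x => (f x - 1) / 2
  | 1 => fun x => 3 / 2 * (formalPower f 1 x / (x : ℂ) - 1)
  | k + 2 => fun x =>
      1 / (legendreMoment (k + 2) (k + 2) : ℂ) *
        (formalPower f (k + 2) x / (x : ℂ) ^ (k + 2) - 1 -
          ∑ j : Fin (k + 1), if (j : ℕ) % 2 = k % 2 then
            (legendreMoment j (k + 2) : ℂ) * beta f j x else 0)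
  termination_by k => k
  decreasing_by omega

end Transmutation

/-!
The expansion holds because the moments of a transmutation kernel are explicit and the Legendre
series of a `C¹` function converges uniformly; existence of a kernel is a Goursat problem.

*Moments.* Let `T` be the Volterra operator of a transmutation kernel and `w_k = T[t ^ k]`. The
intertwining relation gives `w_k'' = q w_k + k (k - 1) w_{k-2}`, so the Wronskian `f w_k' - f' w_k`
has derivative `k (k - 1) f w_{k-2}`; integrating it, and then
`(w_k / f)' = (f w_k' - f' w_k) / f²`, reproduces the recursive integrals. Hence
`w_k = φ_k` on `[0, b]` (`IsTransmutationKernel.volterraOp_pow_eq_formalPower`), that is,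
`g(s) = x K(x, x s)` has the moments `φ_k(x) / x ^ k - 1` on `[-1, 1]`. Expanding `s ^ k` in Legendre
polynomials turns these
moments into a triangular system for the Legendre coefficients of `g`, whose solution is the
recursion for `β` (`beta_eq_legendreCoeffC`); expanding `P_n` in powers gives the closed form, the
`-1` being `-P_n(1)`.

*Convergence.* For `g` of class `C¹`, the partial sums of the Legendre series of `g'` converge to
`g'` in mean square. Subtracting from `g` an antiderivative of such a partial sum leaves a function
`h` that is uniformly small, all but three of whose relevant coefficients vanish. Of those three the
zeroth is small with `h`, and the last two because the differential equation
`((1 - x²) P_n')' = -n (n + 1) P_n` bounds `∫ h P_n` by `O(n^{-3/2})` times the mean-square norm of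
`h'`. Together with `|P_n| ≤ 1`, which also comes from that equation, this yields uniform
convergence on the closed interval (`tendstoUniformlyOn_legendreProj`).

*Existence.* In the coordinates `α = (x + t) / 2`, `β = (x - t) / 2` the kernel is sought as
`K(x, t) = H(α, β)` with `∂_α ∂_β H = q(α + β) H`, `H(α, 0) = f'(0) / 2 + ½ ∫₀^α q` and
`∂_β H(0, β) = 0`. This Goursat problem is solved by a contraction argument (`exists_goursat`).
Since `q` is only continuous, `H` has a mixed second derivative but in general no pure ones; the
integral of `K u` is therefore differentiated twice by writing each term in the characteristic
coordinate in which only the mixed derivative appears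
(`IsGoursatSolution.hasDerivAt_two_charIntLeft`). Finally `T[1] = f` by uniqueness for the
initial value problem.
-/

namespace Transmutation

/-! ### Legendre polynomials -/

section

open Polynomial

lemma derivative_X_sq : derivative (X ^ 2 : ℝ[X]) = 2 * X := by
  rw [pow_two, derivative_mul, derivative_X]
  ring

/-- Leibniz's formula for the factor `X ^ 2 - 1`, which has only three terms. -/
lemma iterate_derivative_X_sq_sub_one_mul (v : ℝ[X]) (k : ℕ) :
    derivative^[k + 2] ((X ^ 2 - 1) * v) =
      (X ^ 2 - 1) * derivative^[k + 2] v + 2 * ((k : ℝ[X]) + 2) * X * derivative^[k + 1] v +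
        ((k : ℝ[X]) + 2) * ((k : ℝ[X]) + 1) * derivative^[k] v := by
  induction k with
  | zero =>
    simp only [Function.iterate_succ_apply', Function.iterate_zero, id_eq, derivative_mul,
      derivative_sub, derivative_add, derivative_X_sq, derivative_one, derivative_X,
      derivative_ofNat, derivative_zero]
    push_cast
    ring
  | succ k ih =>
    rw [Function.iterate_succ_apply', ih]
    simp only [derivative_add, derivative_mul, derivative_sub, derivative_X_sq, derivative_one,
      derivative_X, derivative_natCast, derivative_ofNat, Function.iterate_succ_apply']
    push_cast
    ring

/-- Legendre's differential equation `((1 - x²) P')' = -n (n + 1) P`. -/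
lemma derivative_one_sub_X_sq_mul_derivative_legendre (n : ℕ) :
    derivative ((1 - X ^ 2) * derivative (legendre n)) =
      -(((n : ℝ[X]) * ((n : ℝ[X]) + 1)) * legendre n) := by
  rcases n with _ | n
  · simp [legendre]
  set u : ℝ[X] := (X ^ 2 - 1) ^ (n + 1) with hu
  have h1 : (X ^ 2 - 1) * derivative u = (2 * ((n : ℝ[X]) + 1)) * (u * X) := by
    rw [hu, derivative_pow_succ]
    simp
    ring
  have h2 : derivative^[n + 2] ((X ^ 2 - 1) * derivative u) =
      derivative^[n + 2] ((2 * ((n : ℝ[X]) + 1)) * (u * X)) := by rw [h1]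
  have h3 : (2 * ((n : ℝ[X]) + 1)) = ((2 * (n + 1) : ℕ) : ℝ[X]) := by push_cast; ring
  rw [iterate_derivative_X_sq_sub_one_mul, h3, iterate_derivative_natCast_mul,
    iterate_derivative_mul_X, ← Function.iterate_succ_apply, ← Function.iterate_succ_apply,
    ← Function.iterate_succ_apply] at h2
  have h4 : legendre (n + 1) = C (1 / (2 ^ (n + 1) * ((n + 1).factorial : ℝ))) *
    derivative^[n + 1] u := rfl
  have h5 : derivative^[n + 3] u = derivative (derivative (derivative^[n + 1] u)) := by
    simp only [Function.iterate_succ_apply']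
  have h6 : derivative^[n + 2] u = derivative (derivative^[n + 1] u) := by
    simp only [Function.iterate_succ_apply']
  simp only [Nat.succ_eq_add_one] at h2
  rw [show n + 2 + 1 = n + 3 from rfl, show n + 1 + 1 = n + 2 from rfl, h5, h6] at h2
  rw [h4]
  simp only [derivative_mul, derivative_C, zero_mul, zero_add, derivative_sub, derivative_one,
    derivative_X_sq]
  simp only [nsmul_eq_mul] at h2 ⊢
  push_cast at h2 ⊢
  linear_combination (-C (1 / (2 ^ (n + 1) * ((n + 1).factorial : ℝ)))) * h2

lemma legendre_zero : legendre 0 = 1 := by simp [legendre]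

lemma legendre_eval_one (n : ℕ) : (legendre n).eval 1 = 1 := by
  have h := aeval_iterate_derivative_self ((X ^ 2 - 1 : ℝ[X]) ^ n) n (1 : ℝ)
    (p' := (X + 1) ^ n) (by simp [← mul_pow]; congr 1; ring)
  rw [coe_aeval_eq_eval] at h
  rw [legendre, eval_mul, h]
  simp
  have : ((n.factorial : ℕ) : ℝ) ≠ 0 := by positivity
  field_simp
  norm_num

lemma iterate_derivative_comp_neg_X (p : ℝ[X]) (n : ℕ) :
    (derivative^[n] p).comp (-X) = (-1) ^ n * derivative^[n] (p.comp (-X)) := by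
  induction n generalizing p with
  | zero => simp
  | succ n ih =>
    rw [Function.iterate_succ_apply, ih, Function.iterate_succ_apply, derivative_comp]
    simp [pow_succ]

lemma legendre_eval_neg (n : ℕ) (x : ℝ) :
    (legendre n).eval (-x) = (-1) ^ n * (legendre n).eval x := by
  have h := iterate_derivative_comp_neg_X ((X ^ 2 - 1) ^ n) n
  have h2 : ((X ^ 2 - 1 : ℝ[X]) ^ n).comp (-X) = (X ^ 2 - 1) ^ n := by simp
  rw [h2] at h
  have h3 := congrArg (eval x) h
  simp only [eval_comp, eval_neg, eval_X, eval_mul, eval_pow, eval_one] at h3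
  rw [legendre, eval_mul, eval_mul, h3]
  simp
  ring

lemma natDegree_X_sq_sub_one_pow (n : ℕ) : ((X ^ 2 - 1 : ℝ[X]) ^ n).natDegree = 2 * n := by
  rw [natDegree_pow, show (X ^ 2 - 1 : ℝ[X]) = X ^ 2 - C 1 by simp, natDegree_X_pow_sub_C]
  ring

lemma natDegree_legendre_le (n : ℕ) : (legendre n).natDegree ≤ n := by
  rw [legendre]
  refine (natDegree_C_mul_le _ _).trans ((natDegree_iterate_derivative _ _).trans ?_)
  rw [natDegree_X_sq_sub_one_pow]
  omega

lemma coeff_legendre_self_pos (n : ℕ) : 0 < (legendre n).coeff n := by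
  have h : ((X ^ 2 - 1 : ℝ[X]) ^ n).coeff (n + n) = 1 := by
    have hm : ((X ^ 2 - 1 : ℝ[X]) ^ n).Monic := by
      rw [show (X ^ 2 - 1 : ℝ[X]) = X ^ 2 - C 1 by simp]
      exact (monic_X_pow_sub_C _ two_ne_zero).pow n
    have := hm.coeff_natDegree
    rwa [natDegree_X_sq_sub_one_pow, two_mul] at this
  rw [legendre, coeff_C_mul, coeff_iterate_derivative, h]
  have : 0 < (n + n).descFactorial n := Nat.descFactorial_pos.2 (by omega)
  simp only [nsmul_eq_mul, mul_one]
  positivity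

/-! ### Orthogonality and bounds -/

lemma intervalIntegrable_eval (p : ℝ[X]) (a b : ℝ) :
    IntervalIntegrable (fun x => p.eval x) MeasureTheory.volume a b :=
  p.continuous.intervalIntegrable _ _

lemma integral_eval_derivative (p : ℝ[X]) (a b : ℝ) :
    ∫ x in a..b, (derivative p).eval x = p.eval b - p.eval a :=
  intervalIntegral.integral_eq_sub_of_hasDerivAt (fun x _ => p.hasDerivAt x)
    (intervalIntegrable_eval _ _ _)

/-- Green's identity for the Legendre operator applied to `P_n` and a polynomial `p`. -/
lemma integral_legendre_mul_operator (n : ℕ) (p : ℝ[X]) :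
    ∫ x in (-1 : ℝ)..1, (legendre n * derivative ((1 - X ^ 2) * derivative p)).eval x =
      -((n : ℝ) * (n + 1)) * ∫ x in (-1 : ℝ)..1, (legendre n * p).eval x := by
  have h := integral_eval_derivative
    ((1 - X ^ 2) * (legendre n * derivative p - derivative (legendre n) * p)) (-1) 1
  have h1 : derivative ((1 - X ^ 2) * (legendre n * derivative p - derivative (legendre n) * p)) =
      legendre n * derivative ((1 - X ^ 2) * derivative p) +
        C ((n : ℝ) * (n + 1)) * (legendre n * p) := by
    have := derivative_one_sub_X_sq_mul_derivative_legendre n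
    simp only [derivative_mul, derivative_sub, derivative_one, derivative_X_sq] at this ⊢
    simp only [map_mul, map_add, map_natCast, map_one]
    linear_combination (-p) * this
  rw [h1] at h
  simp only [eval_add, eval_C_mul] at h
  rw [intervalIntegral.integral_add (intervalIntegrable_eval _ _ _)
    ((intervalIntegrable_eval _ _ _).const_mul _), intervalIntegral.integral_const_mul] at h
  have h0 : ∀ y : ℝ, y ^ 2 = 1 →
      ((1 - X ^ 2) * (legendre n * derivative p - derivative (legendre n) * p)).eval y = 0 := by
    intro y hy
    simp [hy]
  rw [h0 1 (by norm_num), h0 (-1) (by norm_num)] at h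
  linarith

/-- `P_n` is orthogonal to lower powers: on `X ^ k` the self-adjoint Legendre operator acts as
`-k (k + 1)` up to a multiple of `X ^ (k - 2)`, and `k (k + 1) ≠ n (n + 1)`. -/
lemma integral_legendre_mul_X_pow_of_lt {n k : ℕ} (h : k < n) :
    ∫ x in (-1 : ℝ)..1, (legendre n * X ^ k).eval x = 0 := by
  induction k using Nat.strong_induction_on with
  | _ k ih =>
    have hop : derivative ((1 - X ^ 2) * derivative (X ^ k : ℝ[X])) =
        C ((k : ℝ) * (k - 1)) * X ^ (k - 2) - C ((k : ℝ) * (k + 1)) * X ^ k := by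
      rcases k with _ | _ | k
      · simp
      · simp
      · have hd : (1 - X ^ 2) * derivative (X ^ (k + 2) : ℝ[X]) =
            C ((k : ℝ) + 2) * X ^ (k + 1) - C ((k : ℝ) + 2) * X ^ (k + 3) := by
          rw [derivative_X_pow]
          simp only [Nat.cast_add, Nat.cast_ofNat,
            show k + 2 - 1 = k + 1 from rfl]
          ring
        rw [hd]
        simp only [derivative_sub, derivative_C_mul, derivative_X_pow, Nat.add_sub_cancel,
          show k + 3 - 1 = k + 2 from rfl]
        simp only [map_mul, map_add, map_sub, map_natCast, map_one, C_ofNat]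
        push_cast
        ring
    have h1 := integral_legendre_mul_operator n (X ^ k)
    rw [hop] at h1
    have h2 : legendre n * (C ((k : ℝ) * (k - 1)) * X ^ (k - 2) - C ((k : ℝ) * (k + 1)) * X ^ k) =
        C ((k : ℝ) * (k - 1)) * (legendre n * X ^ (k - 2)) -
          C ((k : ℝ) * (k + 1)) * (legendre n * X ^ k) := by ring
    rw [h2] at h1
    simp only [eval_sub, eval_C_mul] at h1
    rw [intervalIntegral.integral_sub ((intervalIntegrable_eval _ _ _).const_mul _)
      ((intervalIntegrable_eval _ _ _).const_mul _), intervalIntegral.integral_const_mul,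
      intervalIntegral.integral_const_mul] at h1
    have h3 : (k : ℝ) * (k - 1) * ∫ x in (-1 : ℝ)..1, (legendre n * X ^ (k - 2)).eval x = 0 := by
      rcases k with _ | _ | k
      · simp
      · simp
      · rw [ih (k + 2 - 2) (by omega) (by omega), mul_zero]
    rw [h3] at h1
    have hkn : (k : ℝ) + 1 ≤ n := by exact_mod_cast h
    have h4 : ((n : ℝ) * (n + 1) - k * (k + 1)) *
        ∫ x in (-1 : ℝ)..1, (legendre n * X ^ k).eval x = 0 := by linarith
    have hk0 : (0 : ℝ) ≤ k := by positivity
    exact (mul_eq_zero.1 h4).resolve_left (by nlinarith)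

lemma integral_legendre_mul_of_degree_lt {n : ℕ} {p : ℝ[X]} (hp : p.degree < n) :
    ∫ x in (-1 : ℝ)..1, (legendre n).eval x * p.eval x = 0 := by
  rcases eq_or_ne p 0 with rfl | hp0
  · simp
  have hN : p.natDegree < n := (natDegree_lt_iff_degree_lt hp0).2 hp
  have h : ∀ x : ℝ, (legendre n).eval x * p.eval x =
      ∑ k ∈ Finset.range n, p.coeff k * (legendre n * X ^ k).eval x := by
    intro x
    conv_lhs => rw [p.as_sum_range' n hN]
    rw [eval_finsetSum, Finset.mul_sum]
    refine Finset.sum_congr rfl fun k _ => ?_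
    simp [eval_monomial]
    ring
  simp_rw [h]
  rw [intervalIntegral.integral_finsetSum
    fun k _ => (intervalIntegrable_eval _ _ _).const_mul _]
  refine Finset.sum_eq_zero fun k hk => ?_
  rw [intervalIntegral.integral_const_mul,
    integral_legendre_mul_X_pow_of_lt (Finset.mem_range.1 hk), mul_zero]

lemma degree_sub_lt_of_coeff_eq {n : ℕ} {p r : ℝ[X]} (hp : p.natDegree ≤ n) (hr : r.natDegree ≤ n)
    (h : p.coeff n = r.coeff n) : (p - r).degree < n := by
  rw [degree_lt_iff_coeff_zero]
  intro m hm
  rcases hm.eq_or_lt with rfl | hm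
  · simp [h]
  · rw [coeff_sub, coeff_eq_zero_of_natDegree_lt (by omega),
      coeff_eq_zero_of_natDegree_lt (by omega), sub_zero]

/-- The norm of `P_n`, from integrating `(x P_n²)'`: the polynomial `x P_n' - n P_n` has degree less
than `n`, so `∫ P_n x P_n' = n ∫ P_n²`. -/
lemma integral_legendre_sq (n : ℕ) :
    ∫ x in (-1 : ℝ)..1, (legendre n).eval x * (legendre n).eval x = 2 / (2 * n + 1) := by
  have h := integral_eval_derivative (X * (legendre n * legendre n)) (-1) 1
  have hd : (X * derivative (legendre n) - C (n : ℝ) * legendre n).degree < (n : WithBot ℕ) := by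
    apply degree_sub_lt_of_coeff_eq
    · rcases Nat.eq_zero_or_pos n with rfl | hn
      · simp [legendre_zero]
      · refine natDegree_mul_le.trans ?_
        have := natDegree_derivative_le (legendre n)
        have := natDegree_legendre_le n
        simp
        omega
    · exact (natDegree_C_mul_le _ _).trans (natDegree_legendre_le n)
    · rcases n with _ | n
      · simp
      · rw [coeff_X_mul, coeff_derivative, coeff_C_mul]
        push_cast
        ring
  have h0 := integral_legendre_mul_of_degree_lt hd
  have h1 : ∀ x : ℝ, (derivative (X * (legendre n * legendre n))).eval x =
      (2 * n + 1) * ((legendre n).eval x * (legendre n).eval x) +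
      2 * ((legendre n).eval x *
        (X * derivative (legendre n) - C (n : ℝ) * legendre n).eval x) := by
    intro x
    simp
    ring
  simp_rw [h1] at h
  rw [intervalIntegral.integral_add (Continuous.intervalIntegrable (by fun_prop) _ _)
      (Continuous.intervalIntegrable (by fun_prop) _ _),
    intervalIntegral.integral_const_mul, intervalIntegral.integral_const_mul, h0] at h
  have hm : (legendre n).eval (-1) * (legendre n).eval (-1) = 1 := by
    rw [legendre_eval_neg, legendre_eval_one]
    simp [← mul_pow]
  simp only [eval_mul, eval_X, legendre_eval_one, hm] at h
  rw [eq_div_iff (by positivity)]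
  linarith

/-- `|P_n| ≤ 1` on `[-1, 1]`: the energy `n (n + 1) P_n² + (1 - x²) P_n'²` is monotone on `[0, 1]`,
having derivative `2 x P_n'²`. -/
lemma abs_legendre_eval_le_one (n : ℕ) {x : ℝ} (hx : x ∈ Set.Icc (-1 : ℝ) 1) :
    |(legendre n).eval x| ≤ 1 := by
  have key : ∀ y ∈ Set.Icc (0 : ℝ) 1, |(legendre n).eval y| ≤ 1 := by
    intro y hy
    rcases Nat.eq_zero_or_pos n with rfl | hn
    · simp [legendre_zero]
    set E : ℝ[X] := C ((n : ℝ) * (n + 1)) * legendre n ^ 2 +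
      (1 - X ^ 2) * derivative (legendre n) ^ 2 with hE
    have hdE : derivative E = 2 * X * derivative (legendre n) ^ 2 := by
      have := derivative_one_sub_X_sq_mul_derivative_legendre n
      rw [hE]
      simp only [derivative_mul, derivative_sub, derivative_one, derivative_add,
        derivative_C, derivative_sq, derivative_X] at this ⊢
      simp only [map_mul, map_add, map_natCast, map_one, C_ofNat] at this ⊢
      linear_combination (2 * derivative (legendre n)) * this
    have hmono : MonotoneOn (fun y => E.eval y) (Set.Icc 0 1) := by
      apply monotoneOn_of_deriv_nonneg (convex_Icc 0 1) E.continuous.continuousOn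
        E.differentiable.differentiableOn
      intro z hz
      rw [interior_Icc] at hz
      rw [Polynomial.deriv, hdE]
      simp
      have := hz.1
      positivity
    have h1 := hmono hy (Set.right_mem_Icc.2 zero_le_one) hy.2
    simp [hE, legendre_eval_one] at h1
    have h2 : 0 ≤ (1 - y ^ 2) * (derivative (legendre n)).eval y ^ 2 :=
      mul_nonneg (by nlinarith [hy.1, hy.2]) (sq_nonneg _)
    have hn' : (0 : ℝ) < n := by exact_mod_cast hn
    have h3 : (n : ℝ) * (n + 1) * ((legendre n).eval y ^ 2) ≤ n * (n + 1) * 1 := by linarith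
    have h4 := le_of_mul_le_mul_left h3 (by positivity)
    exact (sq_le_one_iff_abs_le_one _).1 h4
  rcases le_total 0 x with h | h
  · exact key x ⟨h, hx.2⟩
  · have := key (-x) ⟨by linarith, by linarith [hx.1]⟩
    rw [legendre_eval_neg] at this
    simpa [abs_mul] using this

/-- Up to the factor `-n (n + 1)`, the function `(1 - x²) P_n'` is the antiderivative of `P_n`
vanishing at `±1`; its mean-square size comes from integrating `((1 - x²) P_n' P_n)'`. -/
lemma integral_sq_one_sub_X_sq_mul_derivative_legendre_le (n : ℕ) :
    ∫ x in (-1 : ℝ)..1, ((1 - x ^ 2) * (derivative (legendre n)).eval x) ^ 2 ≤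
      (n : ℝ) * (n + 1) * (2 / (2 * n + 1)) := by
  have h := integral_eval_derivative ((1 - X ^ 2) * derivative (legendre n) * legendre n) (-1) 1
  have h1 : ∀ x : ℝ, (derivative ((1 - X ^ 2) * derivative (legendre n) * legendre n)).eval x =
      (1 - x ^ 2) * (derivative (legendre n)).eval x ^ 2 -
        n * (n + 1) * ((legendre n).eval x * (legendre n).eval x) := by
    intro x
    rw [derivative_mul, derivative_one_sub_X_sq_mul_derivative_legendre]
    simp
    ring
  simp_rw [h1] at h
  have c1 : Continuous fun x : ℝ => (1 - x ^ 2) * (derivative (legendre n)).eval x ^ 2 := by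
    fun_prop
  have c2 : Continuous fun x : ℝ => (legendre n).eval x * (legendre n).eval x := by
    fun_prop
  rw [intervalIntegral.integral_sub (c1.intervalIntegrable _ _)
    ((c2.intervalIntegrable _ _).const_mul _),
    intervalIntegral.integral_const_mul, integral_legendre_sq] at h
  simp at h
  refine le_trans (intervalIntegral.integral_mono_on (by norm_num)
    (Continuous.intervalIntegrable (by fun_prop) _ _) (c1.intervalIntegrable _ _) ?_) (by linarith)
  intro x hx
  have : (1 - x ^ 2) ^ 2 ≤ 1 - x ^ 2 := by 
    nlinarith [mul_nonneg (sub_nonneg.2 hx.2) (by linarith [hx.1] : 0 ≤ 1 + x), sq_nonneg x]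
  rw [mul_pow]
  exact mul_le_mul_of_nonneg_right this (sq_nonneg _)

end

/-! ### Uniform convergence of Legendre series of `C¹` functions -/

section

open Polynomial

/-- The `n`-th Fourier–Legendre coefficient of `φ` on `[-1, 1]`. -/
noncomputable def legendreCoeff (φ : ℝ → ℝ) (n : ℕ) : ℝ :=
  (2 * n + 1) / 2 * ∫ x in (-1 : ℝ)..1, φ x * (legendre n).eval x

/-- The projection of `φ` onto the polynomials of degree less than `N`: the sum of the first `N`
terms of its Fourier–Legendre series. -/
noncomputable def legendreProj (φ : ℝ → ℝ) (N : ℕ) : ℝ[X] :=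
  ∑ j ∈ Finset.range N, C (legendreCoeff φ j) * legendre j

lemma degree_legendre_lt {j N : ℕ} (h : j < N) : (legendre j).degree < N :=
  (degree_le_of_natDegree_le (natDegree_legendre_le j)).trans_lt (by exact_mod_cast h)

lemma integral_legendre_mul_legendre_of_ne {i j : ℕ} (h : i ≠ j) :
    ∫ x in (-1 : ℝ)..1, (legendre i).eval x * (legendre j).eval x = 0 := by
  rcases h.lt_or_gt with h | h
  · simp_rw [mul_comm (eval _ (legendre i))]
    exact integral_legendre_mul_of_degree_lt (degree_legendre_lt h)
  · exact integral_legendre_mul_of_degree_lt (degree_legendre_lt h)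

lemma exists_eq_sum_legendre {N : ℕ} {p : ℝ[X]} (hp : p.degree < N) :
    ∃ a : ℕ → ℝ, p = ∑ j ∈ Finset.range N, C (a j) * legendre j := by
  induction N generalizing p with
  | zero =>
    refine ⟨0, ?_⟩
    simpa using hp
  | succ N ih =>
    set c := p.coeff N / (legendre N).coeff N
    have hd : (p - C c * legendre N).degree < N := by
      apply degree_sub_lt_of_coeff_eq
      · rw [natDegree_le_iff_degree_le]
        rw [degree_lt_iff_coeff_zero] at hp
        rw [degree_le_iff_coeff_zero]
        exact fun m hm => hp m (by exact_mod_cast hm)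
      · exact (natDegree_C_mul_le _ _).trans (natDegree_legendre_le N)
      · rw [coeff_C_mul, div_mul_cancel₀ _ (coeff_legendre_self_pos N).ne']
    obtain ⟨a, ha⟩ := ih hd
    refine ⟨Function.update a N c, ?_⟩
    rw [Finset.sum_range_succ, Function.update_self,
      Finset.sum_congr rfl (g := fun j => C (a j) * legendre j), ← ha]
    · ring
    · intro j hj
      rw [Function.update_of_ne (Finset.mem_range.1 hj).ne]

lemma legendreCoeff_sum_legendre (a : ℕ → ℝ) {N i : ℕ} (hi : i < N) :
    legendreCoeff (fun x => (∑ j ∈ Finset.range N, C (a j) * legendre j).eval x) i = a i := by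
  unfold legendreCoeff
  simp_rw [eval_finsetSum, Finset.sum_mul, eval_mul, eval_C, mul_assoc]
  rw [intervalIntegral.integral_finsetSum
    fun j _ => Continuous.intervalIntegrable (by fun_prop) _ _]
  simp_rw [intervalIntegral.integral_const_mul]
  rw [Finset.sum_eq_single_of_mem i (Finset.mem_range.2 hi), integral_legendre_sq]
  · field_simp
  · intro j _ hj
    rw [integral_legendre_mul_legendre_of_ne hj, mul_zero]

/-- The projection reproduces polynomials of degree less than `N`. -/
lemma legendreProj_eval_of_degree_lt {N : ℕ} {p : ℝ[X]} (hp : p.degree < N) :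
    legendreProj (fun x => p.eval x) N = p := by
  obtain ⟨a, rfl⟩ := exists_eq_sum_legendre hp
  exact Finset.sum_congr rfl fun i hi => by
    rw [legendreCoeff_sum_legendre a (Finset.mem_range.1 hi)]

lemma legendreCoeff_sub {φ ψ : ℝ → ℝ} (hφ : Continuous φ) (hψ : Continuous ψ) (n : ℕ) :
    legendreCoeff (fun x => φ x - ψ x) n = legendreCoeff φ n - legendreCoeff ψ n := by
  unfold legendreCoeff
  simp_rw [sub_mul]
  rw [intervalIntegral.integral_sub (Continuous.intervalIntegrable (by fun_prop) _ _)
    (Continuous.intervalIntegrable (by fun_prop) _ _), mul_sub]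

lemma legendreProj_sub {φ ψ : ℝ → ℝ} (hφ : Continuous φ) (hψ : Continuous ψ) (N : ℕ) :
    legendreProj (fun x => φ x - ψ x) N = legendreProj φ N - legendreProj ψ N := by
  simp [legendreProj, legendreCoeff_sub hφ hψ, sub_mul, Finset.sum_sub_distrib]

lemma degree_sum_legendre_lt (a : ℕ → ℝ) (N : ℕ) :
    (∑ j ∈ Finset.range N, C (a j) * legendre j).degree < N := by
  refine (degree_sum_le _ _).trans_lt ((Finset.sup_lt_iff (WithBot.bot_lt_coe N)).2 fun j hj => ?_)
  exact (degree_le_of_natDegree_le ((natDegree_C_mul_le _ _).trans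
    (natDegree_legendre_le j))).trans_lt (WithBot.coe_lt_coe.2 (Finset.mem_range.1 hj))

lemma degree_legendreProj_lt (φ : ℝ → ℝ) (N : ℕ) : (legendreProj φ N).degree < N :=
  degree_sum_legendre_lt _ N

lemma integral_sub_legendreProj_mul {φ : ℝ → ℝ} (hφ : Continuous φ) {N : ℕ} {p : ℝ[X]}
    (hp : p.degree < N) :
    ∫ x in (-1 : ℝ)..1, (φ x - (legendreProj φ N).eval x) * p.eval x = 0 := by
  obtain ⟨a, rfl⟩ := exists_eq_sum_legendre hp
  simp_rw [eval_finsetSum, Finset.mul_sum, eval_mul, eval_C, mul_left_comm _ (a _)]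
  rw [intervalIntegral.integral_finsetSum
    fun j _ => Continuous.intervalIntegrable (by fun_prop) _ _]
  refine Finset.sum_eq_zero fun j hj => ?_
  rw [intervalIntegral.integral_const_mul]
  have h := legendreCoeff_sub hφ (legendreProj φ N).continuous j
  rw [legendreProj, legendreCoeff_sum_legendre _ (Finset.mem_range.1 hj), sub_self, legendreCoeff,
    mul_eq_zero] at h
  rw [legendreProj, h.resolve_left (by positivity), mul_zero]

/-- The projection is the best mean-square approximation. -/
lemma integral_sq_sub_legendreProj_le {φ : ℝ → ℝ} (hφ : Continuous φ) {N : ℕ} {p : ℝ[X]}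
    (hp : p.degree < N) :
    ∫ x in (-1 : ℝ)..1, (φ x - (legendreProj φ N).eval x) ^ 2 ≤
      ∫ x in (-1 : ℝ)..1, (φ x - p.eval x) ^ 2 := by
  have h := integral_sub_legendreProj_mul hφ (p := legendreProj φ N - p)
    ((degree_sub_le _ _).trans_lt (max_lt (degree_legendreProj_lt φ N) hp))
  have h1 : ∀ x, (φ x - p.eval x) ^ 2 = (φ x - (legendreProj φ N).eval x) ^ 2 +
      (2 * ((φ x - (legendreProj φ N).eval x) * (legendreProj φ N - p).eval x) +
        (legendreProj φ N - p).eval x ^ 2) := by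
    intro x
    rw [eval_sub]
    ring
  simp_rw [h1]
  rw [intervalIntegral.integral_add (Continuous.intervalIntegrable (by fun_prop) _ _)
    (Continuous.intervalIntegrable (by fun_prop) _ _),
    intervalIntegral.integral_add (Continuous.intervalIntegrable (by fun_prop) _ _)
    (Continuous.intervalIntegrable (by fun_prop) _ _), intervalIntegral.integral_const_mul, h]
  have : 0 ≤ ∫ x in (-1 : ℝ)..1, (legendreProj φ N - p).eval x ^ 2 :=
    intervalIntegral.integral_nonneg (by norm_num) fun x _ => sq_nonneg _
  linarith

lemma eventually_integral_sq_sub_legendreProj_le {φ : ℝ → ℝ} (hφ : Continuous φ) {ε : ℝ}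
    (hε : 0 < ε) :
    ∀ᶠ N in Filter.atTop, ∫ x in (-1 : ℝ)..1, (φ x - (legendreProj φ N).eval x) ^ 2 ≤ ε ^ 2 := by
  obtain ⟨p, hp⟩ := exists_polynomial_near_of_continuousOn (-1) 1 φ hφ.continuousOn (ε / 2)
    (by positivity)
  filter_upwards [Filter.eventually_gt_atTop p.natDegree] with N hN
  refine (integral_sq_sub_legendreProj_le hφ
    (degree_le_natDegree.trans_lt (by exact_mod_cast hN))).trans ?_
  have h : ∫ x in (-1 : ℝ)..1, (φ x - p.eval x) ^ 2 ≤ ∫ x in (-1 : ℝ)..1, (ε / 2) ^ 2 := by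
    refine intervalIntegral.integral_mono_on (by norm_num)
      (Continuous.intervalIntegrable (by fun_prop) _ _) (by simp) fun x hx => ?_
    rw [← sq_abs, abs_sub_comm]
    exact pow_le_pow_left₀ (abs_nonneg _) (hp x hx).le 2
  refine h.trans ?_
  simp
  nlinarith

/-- The Cauchy–Schwarz inequality. -/
lemma sq_integral_mul_le {a b : ℝ} (hab : a ≤ b) {φ ψ : ℝ → ℝ} (hφ : Continuous φ)
    (hψ : Continuous ψ) :
    (∫ x in a..b, φ x * ψ x) ^ 2 ≤ (∫ x in a..b, φ x ^ 2) * ∫ x in a..b, ψ x ^ 2 := by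
  have h : ∀ t : ℝ, 0 ≤ (∫ x in a..b, φ x ^ 2) * (t * t) +
      (2 * ∫ x in a..b, φ x * ψ x) * t + ∫ x in a..b, ψ x ^ 2 := by
    intro t
    have h0 : 0 ≤ ∫ x in a..b, (t * φ x + ψ x) ^ 2 :=
      intervalIntegral.integral_nonneg hab fun x _ => sq_nonneg _
    have h1 : ∀ x, (t * φ x + ψ x) ^ 2 = t * t * φ x ^ 2 + (2 * t * (φ x * ψ x) + ψ x ^ 2) := by
      intro x; ring
    simp_rw [h1] at h0
    rw [intervalIntegral.integral_add (Continuous.intervalIntegrable (by fun_prop) _ _)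
      (Continuous.intervalIntegrable (by fun_prop) _ _),
      intervalIntegral.integral_add (Continuous.intervalIntegrable (by fun_prop) _ _)
      (Continuous.intervalIntegrable (by fun_prop) _ _), intervalIntegral.integral_const_mul,
      intervalIntegral.integral_const_mul] at h0
    linarith
  have := discrim_le_zero h
  rw [discrim] at this
  linarith

lemma exists_derivative_eq_and_degree_lt (p : ℝ[X]) {N : ℕ} (hp : p.degree < N) :
    ∃ r : ℝ[X], derivative r = p ∧ r.degree < ((N + 1 : ℕ) : WithBot ℕ) := by
  refine ⟨∑ k ∈ Finset.range N, C (p.coeff k / (k + 1)) * X ^ (k + 1), ?_, ?_⟩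
  · rcases eq_or_ne p 0 with rfl | hp0
    · simp
    conv_rhs => rw [p.as_sum_range_C_mul_X_pow' ((natDegree_lt_iff_degree_lt hp0).2 hp)]
    rw [derivative_sum]
    refine Finset.sum_congr rfl fun k _ => ?_
    rw [derivative_C_mul, derivative_X_pow, ← mul_assoc, ← C_mul, Nat.add_sub_cancel]
    congr 2
    push_cast
    field_simp
  · refine (degree_sum_le _ _).trans_lt
      ((Finset.sup_lt_iff (WithBot.bot_lt_coe _)).2 fun k hk => ?_)
    refine (degree_C_mul_X_pow_le _ _).trans_lt ?_
    have := Finset.mem_range.1 hk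
    exact_mod_cast Nat.succ_lt_succ this

/-- Integration by parts against `P_n`, using Legendre's equation to integrate `P_n`. -/
lemma integral_mul_legendre_eq {h h' : ℝ → ℝ} (hd : ∀ x, HasDerivAt h (h' x) x)
    (hc : Continuous h') (n : ℕ) :
    (n : ℝ) * (n + 1) * ∫ x in (-1 : ℝ)..1, h x * (legendre n).eval x =
      ∫ x in (-1 : ℝ)..1, h' x * ((1 - x ^ 2) * (derivative (legendre n)).eval x) := by
  have hcont : Continuous h := continuous_iff_continuousAt.2 fun x => (hd x).continuousAt
  have h1 : ∀ x, HasDerivAt (fun x => h x * ((1 - X ^ 2) * derivative (legendre n)).eval x)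
      (h' x * ((1 - X ^ 2) * derivative (legendre n)).eval x +
        h x * (derivative ((1 - X ^ 2) * derivative (legendre n))).eval x) x := fun x =>
    (hd x).mul (Polynomial.hasDerivAt _ x)
  have h2 := intervalIntegral.integral_eq_sub_of_hasDerivAt (a := -1) (b := 1) (fun x _ => h1 x)
    (Continuous.intervalIntegrable (by fun_prop) _ _)
  rw [intervalIntegral.integral_add (Continuous.intervalIntegrable (by fun_prop) _ _)
    (Continuous.intervalIntegrable (by fun_prop) _ _),
    derivative_one_sub_X_sq_mul_derivative_legendre] at h2
  have h3 : ∀ x, h x * (-(((n : ℝ[X]) * ((n : ℝ[X]) + 1)) * legendre n)).eval x =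
      -((n : ℝ) * (n + 1)) * (h x * (legendre n).eval x) := by
    intro x
    simp
    ring
  simp_rw [h3] at h2
  rw [intervalIntegral.integral_const_mul] at h2
  simp at h2
  linarith

/-- The gain of a derivative: `∫ h P_n` is of order `n^{-3/2}` times the mean-square size of `h'`,
which compensates the factor `(2 n + 1) / 2` of the coefficient. -/
lemma abs_legendreCoeff_le {h h' : ℝ → ℝ} (hd : ∀ x, HasDerivAt h (h' x) x)
    (hc : Continuous h') {δ : ℝ} (hδ : 0 ≤ δ) (hI : ∫ x in (-1 : ℝ)..1, h' x ^ 2 ≤ δ ^ 2)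
    {n : ℕ} (hn : 1 ≤ n) :
    |legendreCoeff h n| ≤ δ := by
  have h1 := integral_mul_legendre_eq hd hc n
  have h2 := sq_integral_mul_le (a := -1) (b := 1) (by norm_num) hc
    (ψ := fun x => (1 - x ^ 2) * (derivative (legendre n)).eval x) (by fun_prop)
  rw [← h1] at h2
  have h3 := h2.trans (mul_le_mul hI (integral_sq_one_sub_X_sq_mul_derivative_legendre_le n)
    (intervalIntegral.integral_nonneg (by norm_num) fun x _ => sq_nonneg _) (sq_nonneg _))
  have hn' : (1 : ℝ) ≤ n := by exact_mod_cast hn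
  refine abs_le_of_sq_le_sq ?_ hδ
  rw [legendreCoeff]
  set J := ∫ x in (-1 : ℝ)..1, h x * (legendre n).eval x
  set m : ℝ := (n : ℝ)
  have h4 : (m * (m + 1)) * J ^ 2 * (2 * m + 1) ≤ 2 * δ ^ 2 := by
    have h5 : (m * (m + 1)) * ((m * (m + 1)) * J ^ 2 * (2 * m + 1)) ≤
        (m * (m + 1)) * (2 * δ ^ 2) := by
      calc _ = (m * (m + 1) * J) ^ 2 * (2 * m + 1) := by ring
        _ ≤ (δ ^ 2 * (m * (m + 1) * (2 / (2 * m + 1)))) * (2 * m + 1) := by gcongr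
        _ = _ := by field_simp
    exact le_of_mul_le_mul_left h5 (by positivity)
  have h6 : (2 * m + 1) ≤ 2 * (m * (m + 1)) := by nlinarith
  calc ((2 * m + 1) / 2 * J) ^ 2 = (2 * m + 1) * (J ^ 2 * (2 * m + 1)) / 4 := by ring
    _ ≤ 2 * (m * (m + 1)) * (J ^ 2 * (2 * m + 1)) / 4 := by gcongr
    _ ≤ δ ^ 2 := by nlinarith

/-- If `h'` is orthogonal to the polynomials of degree less than `N`, the coefficients of `h` of
index between `1` and `N - 2` vanish: the antiderivative of `P_n` is a polynomial of degree
`n + 1`. -/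
lemma legendreCoeff_eq_zero_of_orthogonal {h h' : ℝ → ℝ} (hd : ∀ x, HasDerivAt h (h' x) x)
    (hc : Continuous h') {N : ℕ}
    (ho : ∀ p : ℝ[X], p.degree < N → ∫ x in (-1 : ℝ)..1, h' x * p.eval x = 0)
    {n : ℕ} (hn : 1 ≤ n) (hnN : n + 1 < N) : legendreCoeff h n = 0 := by
  have h1 := integral_mul_legendre_eq hd hc n
  have hdeg : ((1 - X ^ 2) * derivative (legendre n)).degree < (N : WithBot ℕ) := by
    have hnat : ((1 - X ^ 2) * derivative (legendre n)).natDegree ≤ n + 1 := by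
      refine natDegree_mul_le.trans ?_
      have h2 := natDegree_derivative_le (legendre n)
      have h3 := natDegree_legendre_le n
      have h4 : (1 - X ^ 2 : ℝ[X]).natDegree ≤ 2 := by compute_degree
      omega
    exact (degree_le_of_natDegree_le hnat).trans_lt (by exact_mod_cast hnN)
  have h2 := ho _ hdeg
  simp only [eval_mul, eval_sub, eval_one, eval_pow, eval_X] at h2
  rw [h2] at h1
  have hn' : (1 : ℝ) ≤ n := by exact_mod_cast hn
  rw [legendreCoeff, (mul_eq_zero.1 h1).resolve_left (by positivity), mul_zero]

lemma abs_le_two_mul_of_integral_sq_deriv_le {h h' : ℝ → ℝ} (hd : ∀ x, HasDerivAt h (h' x) x)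
    (hc : Continuous h') (h0 : h (-1) = 0) {δ : ℝ} (hδ : 0 ≤ δ)
    (hI : ∫ x in (-1 : ℝ)..1, h' x ^ 2 ≤ δ ^ 2) {x : ℝ} (hx : x ∈ Set.Icc (-1 : ℝ) 1) :
    |h x| ≤ 2 * δ := by
  have h1 : ∫ t in (-1 : ℝ)..x, h' t = h x := by
    rw [intervalIntegral.integral_eq_sub_of_hasDerivAt (fun t _ => hd t)
      (hc.intervalIntegrable _ _), h0, sub_zero]
  have h2 := sq_integral_mul_le hx.1 hc (ψ := fun _ => 1) continuous_const
  simp only [mul_one, h1, one_pow, intervalIntegral.integral_const, smul_eq_mul] at h2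
  have h3 : ∫ t in (-1 : ℝ)..x, h' t ^ 2 ≤ ∫ t in (-1 : ℝ)..1, h' t ^ 2 :=
    intervalIntegral.integral_mono_interval le_rfl hx.1 hx.2
      (Filter.Eventually.of_forall fun t => sq_nonneg _)
      (Continuous.intervalIntegrable (by fun_prop) _ _)
  refine abs_le_of_sq_le_sq ?_ (by positivity)
  have h4 : 0 ≤ ∫ t in (-1 : ℝ)..x, h' t ^ 2 :=
    intervalIntegral.integral_nonneg hx.1 fun x _ => sq_nonneg _
  nlinarith [hx.1, hx.2]

/-- If the derivative `g'` is at mean-square distance at most `δ` from its own partial sum, then `g`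
is uniformly close to its partial sum. Subtracting an antiderivative of the partial sum of `g'`
leaves a small function with at most three nonzero coefficients up to the relevant index. -/
lemma abs_sub_legendreProj_le {g g' : ℝ → ℝ} (hd : ∀ x, HasDerivAt g (g' x) x)
    (hc : Continuous g') {δ : ℝ} (hδ : 0 ≤ δ) {N : ℕ}
    (hI : ∫ x in (-1 : ℝ)..1, (g' x - (legendreProj g' (N + 2)).eval x) ^ 2 ≤ δ ^ 2) {x : ℝ}
    (hx : x ∈ Set.Icc (-1 : ℝ) 1) :
    |g x - (legendreProj g (N + 3)).eval x| ≤ 6 * δ := by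
  have hcont : Continuous g := continuous_iff_continuousAt.2 fun x => (hd x).continuousAt
  obtain ⟨r, hr, hrd⟩ := exists_derivative_eq_and_degree_lt _ (degree_legendreProj_lt g' (N + 2))
  set G : ℝ[X] := r + C (g (-1) - r.eval (-1)) with hG
  have hGd : G.degree < ((N + 3 : ℕ) : WithBot ℕ) :=
    (degree_add_le _ _).trans_lt (max_lt hrd
      (degree_C_le.trans_lt (by exact_mod_cast Nat.succ_pos _)))
  have hG' : derivative G = legendreProj g' (N + 2) := by simp [hG, hr]
  have hGe : G.eval (-1) = g (-1) := by simp [hG]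
  set h : ℝ → ℝ := fun x => g x - G.eval x with hh
  set h' : ℝ → ℝ := fun x => g' x - (legendreProj g' (N + 2)).eval x with hh'
  have hhd : ∀ x, HasDerivAt h (h' x) x := fun x => by
    have := (hd x).sub (G.hasDerivAt x)
    rwa [hG'] at this
  have hhc : Continuous h' := by fun_prop
  have hcont' : Continuous h := by fun_prop
  have hproj : g x - (legendreProj g (N + 3)).eval x = h x - (legendreProj h (N + 3)).eval x := by
    rw [hh, legendreProj_sub hcont G.continuous, legendreProj_eval_of_degree_lt hGd, eval_sub]
    ring
  have hb : ∀ y ∈ Set.Icc (-1 : ℝ) 1, |h y| ≤ 2 * δ := fun y hy =>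
    abs_le_two_mul_of_integral_sq_deriv_le hhd hhc (by simp [hh, hGe]) hδ hI hy
  have h0 : |legendreCoeff h 0| ≤ 2 * δ := by
    have := intervalIntegral.norm_integral_le_of_norm_le_const (a := -1) (b := 1) (f := h)
      (C := 2 * δ) fun y hy => by
        rw [Set.uIoc_of_le (by norm_num)] at hy
        exact hb y ⟨hy.1.le, hy.2⟩
    rw [Real.norm_eq_abs] at this
    norm_num at this
    simp [legendreCoeff, legendre_zero, abs_mul]
    linarith
  have hsum : (legendreProj h (N + 3)).eval x = legendreCoeff h 0 +
      (legendreCoeff h (N + 1) * (legendre (N + 1)).eval x +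
        legendreCoeff h (N + 2) * (legendre (N + 2)).eval x) := by
    rw [legendreProj, Finset.sum_range_succ, Finset.sum_range_succ,
      Finset.sum_eq_single_of_mem 0 (by simp)]
    · simp [legendre_zero]
      ring
    · intro j hj hj0
      rw [legendreCoeff_eq_zero_of_orthogonal (N := N + 2) hhd hhc
        (fun p hp => integral_sub_legendreProj_mul hc hp) (Nat.one_le_iff_ne_zero.2 hj0)
        (by have := Finset.mem_range.1 hj; omega)]
      simp
  have hterm : ∀ n, 1 ≤ n → |legendreCoeff h n * (legendre n).eval x| ≤ δ := fun n hn => by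
    rw [abs_mul]
    calc _ ≤ δ * 1 := mul_le_mul (abs_legendreCoeff_le hhd hhc hδ hI hn)
          (abs_legendre_eval_le_one n hx) (abs_nonneg _) hδ
      _ = δ := mul_one _
  rw [hproj, hsum]
  have e1 := abs_le.1 (hterm (N + 1) (by omega))
  have e2 := abs_le.1 (hterm (N + 2) (by omega))
  have e3 := abs_le.1 h0
  have e4 := abs_le.1 (hb x hx)
  exact abs_le.2 ⟨by linarith, by linarith⟩

theorem tendstoUniformlyOn_legendreProj {g g' : ℝ → ℝ} (hd : ∀ x, HasDerivAt g (g' x) x)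
    (hc : Continuous g') :
    TendstoUniformlyOn (fun N x => (legendreProj g N).eval x) g Filter.atTop
      (Set.Icc (-1 : ℝ) 1) := by
  rw [Metric.tendstoUniformlyOn_iff]
  intro ε hε
  obtain ⟨N₀, hN₀⟩ := Filter.eventually_atTop.1
    (eventually_integral_sq_sub_legendreProj_le hc (ε := ε / 7) (by positivity))
  filter_upwards [Filter.eventually_ge_atTop (N₀ + 3)] with N hN x hx
  obtain ⟨m, rfl⟩ : ∃ m, N = m + 3 := ⟨N - 3, by omega⟩
  rw [Real.dist_eq]
  exact (abs_sub_legendreProj_le hd hc (by positivity) (hN₀ _ (by omega)) hx).trans_lt (by linarith)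

end

/-! ### Extension of `C²` functions and differentiation of integrals -/

section

open Set Function

variable {E : Type*} [NormedAddCommGroup E] [NormedSpace ℝ E]

lemma eqOn_add_integral_of_derivWithin_eq [CompleteSpace E] {a b : ℝ} {v V : ℝ → E}
    (hv : ContDiffOn ℝ 1 v (Icc a b)) (hV : Continuous V)
    (h : EqOn (derivWithin v (Icc a b)) V (Icc a b)) :
    EqOn v (fun x => v a + ∫ t in a..x, V t) (Icc a b) := by
  intro x hx
  have hsub : Icc a x ⊆ Icc a b := Icc_subset_Icc_right hx.2
  have := intervalIntegral.integral_eq_sub_of_hasDerivAt_of_le hx.1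
    (hv.continuousOn.mono hsub) (f' := V) (fun y hy => by
      have hy' : y ∈ Icc a b := hsub (Ioo_subset_Icc_self hy)
      have hn : Icc a b ∈ nhds y := Icc_mem_nhds hy.1 (hy.2.trans_le hx.2)
      have hd := ((hv.differentiableOn one_ne_zero) y hy').hasDerivWithinAt
      rw [h hy'] at hd
      exact hd.hasDerivAt hn) (hV.intervalIntegrable _ _)
  simp [this]

lemma hasDerivAt_const_add_integral [CompleteSpace E] {V : ℝ → E} (hV : Continuous V) (c : E)
    (a x : ℝ) : HasDerivAt (fun x => c + ∫ t in a..x, V t) (V x) x :=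
  (hV.integral_hasStrictDerivAt a x).hasDerivAt.const_add c

/-- A `C¹` function on `[a, b]` extends to a `C¹` function on the line. -/
lemma exists_hasDerivAt_extension [CompleteSpace E] {a b : ℝ} (hab : a < b) {v : ℝ → E}
    (hv : ContDiffOn ℝ 1 v (Icc a b)) :
    ∃ V V1 : ℝ → E, Continuous V1 ∧ (∀ x, HasDerivAt V (V1 x) x) ∧ EqOn v V (Icc a b) := by
  have hc : ContinuousOn (derivWithin v (Icc a b)) (Icc a b) :=
    hv.continuousOn_derivWithin (uniqueDiffOn_Icc hab) le_rfl
  have hV : Continuous (IccExtend hab.le ((Icc a b).domRestrict (derivWithin v (Icc a b)))) :=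
    (continuousOn_iff_continuous_domRestrict.1 hc).Icc_extend'
  refine ⟨_, _, hV, hasDerivAt_const_add_integral hV (v a) a,
    eqOn_add_integral_of_derivWithin_eq hv hV fun x hx => ?_⟩
  rw [IccExtend_of_mem _ _ hx, domRestrict_apply]

/-- A `C²` function on `[a, b]` extends to a `C²` function on the line. -/
lemma exists_hasDerivAt_two_extension [CompleteSpace E] {a b : ℝ} (hab : a < b) {u : ℝ → E}
    (hu : ContDiffOn ℝ 2 u (Icc a b)) :
    ∃ U U1 U2 : ℝ → E, Continuous U2 ∧ (∀ x, HasDerivAt U (U1 x) x) ∧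
      (∀ x, HasDerivAt U1 (U2 x) x) ∧ EqOn u U (Icc a b) := by
  have h1 : ContDiffOn ℝ 1 (derivWithin u (Icc a b)) (Icc a b) :=
    hu.derivWithin (uniqueDiffOn_Icc hab) (by norm_num)
  obtain ⟨U1, U2, hU2, hd, he⟩ := exists_hasDerivAt_extension hab h1
  have hU1 : Continuous U1 := continuous_iff_continuousAt.2 fun x => (hd x).continuousAt
  exact ⟨_, U1, U2, hU2, hasDerivAt_const_add_integral hU1 (u a) a, hd,
    eqOn_add_integral_of_derivWithin_eq (hu.of_le (by norm_num)) hU1 he⟩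

variable {W W1 W2 : ℝ → E}

lemma contDiffOn_two_of_eqOn {s : Set ℝ} {w : ℝ → E} (h1 : ∀ x, HasDerivAt W (W1 x) x)
    (h2 : ∀ x, HasDerivAt W1 (W2 x) x) (hc : Continuous W2) (he : EqOn w W s) :
    ContDiffOn ℝ 2 w s := by
  refine ContDiffOn.congr (ContDiff.contDiffOn ?_) he
  have e1 : deriv W = W1 := funext fun x => (h1 x).deriv
  have e2 : deriv W1 = W2 := funext fun x => (h2 x).deriv
  rw [show (2 : WithTop ℕ∞) = 1 + 1 by norm_num, contDiff_succ_iff_deriv]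
  refine ⟨fun x => (h1 x).differentiableAt, by simp, ?_⟩
  rw [e1, contDiff_one_iff_deriv, e2]
  exact ⟨fun x => (h2 x).differentiableAt, hc⟩

lemma iteratedDerivWithin_two_of_eqOn {a b : ℝ} (hab : a < b) {w : ℝ → E}
    (h1 : ∀ x, HasDerivAt W (W1 x) x) (h2 : ∀ x, HasDerivAt W1 (W2 x) x)
    (he : EqOn w W (Icc a b)) {x : ℝ} (hx : x ∈ Icc a b) :
    iteratedDerivWithin 2 w (Icc a b) x = W2 x := by
  have e1 : EqOn (derivWithin w (Icc a b)) W1 (Icc a b) := fun y hy =>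
    ((h1 y).hasDerivWithinAt.congr he (he hy)).derivWithin (uniqueDiffOn_Icc hab y hy)
  rw [iteratedDerivWithin_succ, iteratedDerivWithin_one]
  exact ((h2 x).hasDerivWithinAt.congr e1 (e1 hx)).derivWithin (uniqueDiffOn_Icc hab x hx)

lemma hasDerivAt_integral_of_continuous {F F' : ℝ → ℝ → E} (hF : Continuous (uncurry F))
    (hF' : Continuous (uncurry F')) (hd : ∀ x a, HasDerivAt (fun x => F x a) (F' x a) x)
    (c y x : ℝ) :
    HasDerivAt (fun x => ∫ a in c..y, F x a) (∫ a in c..y, F' x a) x := by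
  obtain ⟨C, hC⟩ := ((isCompact_Icc (a := x - 1) (b := x + 1)).prod
    (isCompact_uIcc (a := c) (b := y))).exists_bound_of_continuousOn hF'.continuousOn
  have hslice : ∀ z, Continuous (F z) := fun z => hF.comp (Continuous.prodMk_right z)
  refine (intervalIntegral.hasDerivAt_integral_of_dominated_loc_of_deriv_le
    (Icc_mem_nhds (show x - 1 < x by linarith) (show x < x + 1 by linarith))
    (Filter.Eventually.of_forall fun z => (hslice z).aestronglyMeasurable)
    ((hslice x).intervalIntegrable _ _)
    (hF'.comp (Continuous.prodMk_right x)).aestronglyMeasurable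
    (bound := fun _ => C) (Filter.Eventually.of_forall fun a ha z hz =>
      hC (z, a) ⟨hz, uIoc_subset_uIcc ha⟩) (by simp)
    (Filter.Eventually.of_forall fun a _ z _ => hd z a)).2

lemma continuous_integral_of_continuous {F : ℝ → ℝ → E} (hF : Continuous (uncurry F)) (c : ℝ) :
    Continuous (uncurry fun x y => ∫ a in c..y, F x a) :=
  intervalIntegral.continuous_parametric_intervalIntegral_of_continuous
    (f := fun (p : ℝ × ℝ) a => F p.1 a) (by fun_prop) continuous_snd

/-- Leibniz's rule for `∫₀ˣ F(x, a) da`. -/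
lemma hasDerivAt_integral_diag [CompleteSpace E] {F F' : ℝ → ℝ → E} (hF : Continuous (uncurry F))
    (hF' : Continuous (uncurry F')) (hd : ∀ x a, HasDerivAt (fun x => F x a) (F' x a) x) (x : ℝ) :
    HasDerivAt (fun x => ∫ a in (0 : ℝ)..x, F x a) (F x x + ∫ a in (0 : ℝ)..x, F' x a) x := by
  have h := hasStrictFDerivAt_uncurry_coprod (𝕜 := ℝ) (u := (x, x))
    (f := fun x y => ∫ a in (0 : ℝ)..y, F x a)
    (f₁ := fun x y => ContinuousLinearMap.toSpanSingleton ℝ (∫ a in (0 : ℝ)..y, F' x a))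
    (f₂ := fun x y => ContinuousLinearMap.toSpanSingleton ℝ (F x y))
    (Filter.Eventually.of_forall fun v =>
      (hasDerivAt_integral_of_continuous hF hF' hd 0 v.2 v.1).hasFDerivAt)
    (Filter.Eventually.of_forall fun v =>
      ((hF.comp (Continuous.prodMk_right v.1)).integral_hasStrictDerivAt 0
        v.2).hasDerivAt.hasFDerivAt)
    ((ContinuousLinearMap.toSpanSingletonCLE.continuous.comp
      (continuous_integral_of_continuous hF' 0)).continuousAt)
    ((ContinuousLinearMap.toSpanSingletonCLE.continuous.comp hF).continuousAt)
  have h2 := h.hasFDerivAt.comp_hasDerivAt (f := fun x => (x, x)) x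
    ((hasDerivAt_id x).prodMk (hasDerivAt_id x))
  convert! h2 using 1
  simp [HasUncurry.uncurry, add_comm]

/-- A function of two variables with continuous partial derivatives is `C¹`. -/
lemma contDiff_one_of_partial {H A B : ℝ → ℝ → E} (hA : Continuous (uncurry A))
    (hB : Continuous (uncurry B)) (h1 : ∀ x y, HasDerivAt (fun x => H x y) (A x y) x)
    (h2 : ∀ x y, HasDerivAt (fun y => H x y) (B x y) y) : ContDiff ℝ 1 (uncurry H) := by
  have h : ∀ u : ℝ × ℝ, HasStrictFDerivAt (uncurry H)
      ((ContinuousLinearMap.toSpanSingleton ℝ (A u.1 u.2)).coprod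
        (ContinuousLinearMap.toSpanSingleton ℝ (B u.1 u.2))) u := fun u =>
    hasStrictFDerivAt_uncurry_coprod (𝕜 := ℝ) (u := u) (f := H)
      (f₁ := fun x y => ContinuousLinearMap.toSpanSingleton ℝ (A x y))
      (f₂ := fun x y => ContinuousLinearMap.toSpanSingleton ℝ (B x y))
      (Filter.Eventually.of_forall fun v => (h1 v.1 v.2).hasFDerivAt)
      (Filter.Eventually.of_forall fun v => (h2 v.1 v.2).hasFDerivAt)
      ((ContinuousLinearMap.toSpanSingletonCLE.continuous.comp hA).continuousAt)
      ((ContinuousLinearMap.toSpanSingletonCLE.continuous.comp hB).continuousAt)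
  rw [contDiff_one_iff_hasFDerivAt]
  exact ⟨_, (ContinuousLinearMap.toSpanSingletonCLE.continuous.comp hA).continuousLinearMapCoprod
    (ContinuousLinearMap.toSpanSingletonCLE.continuous.comp hB), fun u => (h u).hasFDerivAt⟩

end

/-! ### The Goursat problem -/

section

open Set Function

/-- Integration gains a factor `1 / l` in the weight `cosh (l s)`. -/
lemma norm_integral_le_cosh {φ : ℝ → ℂ} {D l : ℝ} (hl : 0 < l) (hD : 0 ≤ D)
    (h : ∀ s, ‖φ s‖ ≤ D * Real.cosh (l * s)) (α : ℝ) :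
    ‖∫ s in (0 : ℝ)..α, φ s‖ ≤ D / l * Real.cosh (l * α) := by
  have h1 : ∫ s in (0 : ℝ)..α, D * Real.cosh (l * s) = D / l * Real.sinh (l * α) := by
    have hd : ∀ s, HasDerivAt (fun s => D / l * Real.sinh (l * s)) (D * Real.cosh (l * s)) s := by
      intro s
      have := (((hasDerivAt_id s).const_mul l).sinh).const_mul (D / l)
      convert! this using 1
      field_simp
      simp
    rw [intervalIntegral.integral_eq_sub_of_hasDerivAt (fun s _ => hd s)
      (Continuous.intervalIntegrable (by fun_prop) _ _)]
    simp
  refine (intervalIntegral.norm_integral_le_abs_of_norm_le (Filter.Eventually.of_forall h)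
    (Continuous.intervalIntegrable (by fun_prop) _ _)).trans ?_
  rw [h1, abs_mul, abs_of_nonneg (by positivity : 0 ≤ D / l)]
  gcongr
  exact abs_le_of_sq_le_sq (by rw [Real.cosh_sq]; linarith) (Real.cosh_pos _).le

/-- The integral operator of the Goursat problem for `∂_α ∂_β H = Q (α + β) H`. -/
noncomputable def goursatInt (Q : ℝ → ℂ) (V : ℝ → ℝ → ℂ) (α β : ℝ) : ℂ :=
  ∫ s in (0 : ℝ)..α, ∫ r in (0 : ℝ)..β, Q (s + r) * V s r

lemma continuous_goursatInt {Q : ℝ → ℂ} (hQ : Continuous Q) {V : ℝ → ℝ → ℂ}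
    (hV : Continuous (uncurry V)) : Continuous (uncurry (goursatInt Q V)) := by
  have h1 : Continuous (uncurry fun s β => ∫ r in (0 : ℝ)..β, Q (s + r) * V s r) :=
    continuous_integral_of_continuous (F := fun s r => Q (s + r) * V s r)
      ((hQ.comp (continuous_fst.add continuous_snd)).mul hV) 0
  have h2 := continuous_integral_of_continuous
    (F := fun β s => ∫ r in (0 : ℝ)..β, Q (s + r) * V s r) (h1.comp continuous_swap) 0
  exact h2.comp continuous_swap

lemma norm_goursatInt_le {Q : ℝ → ℂ} {M : ℝ} (hM : ∀ x, ‖Q x‖ ≤ M) {V : ℝ → ℝ → ℂ} {D l : ℝ}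
    (hl : 0 < l) (hD : 0 ≤ D)
    (h : ∀ s r, ‖V s r‖ ≤ D * (Real.cosh (l * s) * Real.cosh (l * r))) (α β : ℝ) :
    ‖goursatInt Q V α β‖ ≤ M / l ^ 2 * D * (Real.cosh (l * α) * Real.cosh (l * β)) := by
  have hM0 : 0 ≤ M := (norm_nonneg _).trans (hM 0)
  have h1 : ∀ s, ‖∫ r in (0 : ℝ)..β, Q (s + r) * V s r‖ ≤
      (M * D / l * Real.cosh (l * β)) * Real.cosh (l * s) := by
    intro s
    refine (norm_integral_le_cosh (D := M * D * Real.cosh (l * s)) hl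
      (mul_nonneg (mul_nonneg hM0 hD) (Real.cosh_pos _).le) (fun r => ?_) β).trans_eq (by ring)
    rw [norm_mul]
    calc _ ≤ M * (D * (Real.cosh (l * s) * Real.cosh (l * r))) :=
          mul_le_mul (hM _) (h s r) (norm_nonneg _) hM0
      _ = _ := by ring
  refine (norm_integral_le_cosh hl (mul_nonneg (by positivity) (Real.cosh_pos _).le) h1
    α).trans_eq ?_
  field_simp

lemma goursatInt_sub {Q : ℝ → ℂ} (hQ : Continuous Q) {V W : ℝ → ℝ → ℂ}
    (hV : Continuous (uncurry V)) (hW : Continuous (uncurry W)) (α β : ℝ) :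
    goursatInt Q (fun s r => V s r - W s r) α β = goursatInt Q V α β - goursatInt Q W α β := by
  have hc : ∀ {V : ℝ → ℝ → ℂ}, Continuous (uncurry V) →
      Continuous (uncurry fun s r => Q (s + r) * V s r) := fun hV =>
    (hQ.comp (continuous_fst.add continuous_snd)).mul hV
  have hi : ∀ {V : ℝ → ℝ → ℂ}, Continuous (uncurry V) →
      Continuous fun s => ∫ r in (0 : ℝ)..β, Q (s + r) * V s r := fun hV =>
    (continuous_integral_of_continuous (hc hV) 0).comp (Continuous.prodMk_left β)
  unfold goursatInt
  rw [← intervalIntegral.integral_sub ((hi hV).intervalIntegrable _ _)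
    ((hi hW).intervalIntegrable _ _)]
  refine intervalIntegral.integral_congr fun s _ => ?_
  simp only [mul_sub]
  exact intervalIntegral.integral_sub
    (((hc hV).comp (Continuous.prodMk_right s)).intervalIntegrable _ _)
    (((hc hW).comp (Continuous.prodMk_right s)).intervalIntegrable _ _)

/-- Solvability of the Goursat integral equation on the whole plane, by the contraction principle in
the space of bounded continuous functions with weight `cosh (l α) cosh (l β)`. -/
theorem exists_goursat {Q : ℝ → ℂ} (hQ : Continuous Q) {M : ℝ} (hM : ∀ x, ‖Q x‖ ≤ M) {g : ℝ → ℂ}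
    (hg : Continuous g) (hgr : ∀ l, 1 ≤ l → ∃ C, ∀ α, ‖g α‖ ≤ C * Real.cosh (l * α)) :
    ∃ H : ℝ → ℝ → ℂ, Continuous (uncurry H) ∧ ∀ α β, H α β = g α + goursatInt Q H α β := by
  have hM0 : 0 ≤ M := (norm_nonneg _).trans (hM 0)
  -- this choice of `l` makes `M / l ^ 2` at most `1 / 2`
  set l : ℝ := 1 + 2 * M with hl
  have hl1 : 1 ≤ l := by linarith
  have hl0 : 0 < l := by linarith
  have hMl : M / l ^ 2 ≤ 1 / 2 := by
    rw [div_le_iff₀ (by positivity)]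
    nlinarith
  obtain ⟨C, hC⟩ := hgr l hl1
  have hC0 : 0 ≤ C := by simpa using (norm_nonneg _).trans (hC 0)
  set w : ℝ × ℝ → ℝ := fun p => Real.cosh (l * p.1) * Real.cosh (l * p.2) with hw
  have hwc : Continuous w := by fun_prop
  have hw0 : ∀ p, 0 < w p := fun p => mul_pos (Real.cosh_pos _) (Real.cosh_pos _)
  let wt : BoundedContinuousFunction (ℝ × ℝ) ℂ → ℝ → ℝ → ℂ := fun G s r => (w (s, r) : ℂ) * G (s, r)
  have hwt : ∀ G, Continuous (uncurry (wt G)) := fun G =>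
    (Complex.continuous_ofReal.comp hwc).mul G.continuous
  have hwtn : ∀ (G : BoundedContinuousFunction (ℝ × ℝ) ℂ) s r, ‖wt G s r‖ ≤ ‖G‖ * w (s, r) := by
    intro G s r
    simp only [wt, norm_mul, Complex.norm_real, Real.norm_eq_abs, abs_of_pos (hw0 _)]
    rw [mul_comm]
    exact mul_le_mul_of_nonneg_right (G.norm_coe_le_norm _) (hw0 _).le
  have hgw : ∀ p : ℝ × ℝ, ‖g p.1‖ ≤ C * w p := by
    intro p
    refine (hC p.1).trans (mul_le_mul_of_nonneg_left ?_ hC0)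
    exact le_mul_of_one_le_right (Real.cosh_pos _).le (Real.one_le_cosh _)
  have hcont : ∀ G, Continuous fun p : ℝ × ℝ =>
      (g p.1 + goursatInt Q (wt G) p.1 p.2) / (w p : ℂ) := fun G =>
    ((hg.comp continuous_fst).add (continuous_goursatInt hQ (hwt G))).div
      (Complex.continuous_ofReal.comp hwc) fun p => by
        simpa using (hw0 p).ne'
  let Φ : BoundedContinuousFunction (ℝ × ℝ) ℂ → BoundedContinuousFunction (ℝ × ℝ) ℂ := fun G =>
    BoundedContinuousFunction.ofNormedAddCommGroup
      (fun p => (g p.1 + goursatInt Q (wt G) p.1 p.2) / (w p : ℂ)) (hcont G)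
      (C + M / l ^ 2 * ‖G‖) (fun p => by
        rw [norm_div, Complex.norm_real, Real.norm_eq_abs, abs_of_pos (hw0 p), div_le_iff₀ (hw0 p)]
        refine (norm_add_le _ _).trans ((add_le_add (hgw p)
          (norm_goursatInt_le hM hl0 (norm_nonneg G) (hwtn G) p.1 p.2)).trans_eq ?_)
        simp only [hw]
        ring)
  have hΦa : ∀ G p, Φ G p = (g p.1 + goursatInt Q (wt G) p.1 p.2) / (w p : ℂ) := fun _ _ => rfl
  have hΦ : ContractingWith (1 / 2) Φ := by
    refine ⟨by norm_num, LipschitzWith.of_dist_le_mul fun G₁ G₂ => ?_⟩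
    rw [BoundedContinuousFunction.dist_le (by positivity)]
    intro p
    have h1 : Φ G₁ p - Φ G₂ p = goursatInt Q (wt (G₁ - G₂)) p.1 p.2 / (w p : ℂ) := by
      have h2 : wt (G₁ - G₂) = fun s r => wt G₁ s r - wt G₂ s r := by
        funext s r
        simp [wt, mul_sub]
      rw [h2, goursatInt_sub hQ (hwt _) (hwt _), hΦa, hΦa]
      ring
    rw [dist_eq_norm, h1, norm_div, Complex.norm_real, Real.norm_eq_abs, abs_of_pos (hw0 p),
      div_le_iff₀ (hw0 p), dist_eq_norm]
    refine (norm_goursatInt_le hM hl0 (norm_nonneg (G₁ - G₂)) (hwtn (G₁ - G₂)) p.1 p.2).trans ?_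
    have : M / l ^ 2 * ‖G₁ - G₂‖ ≤ 1 / 2 * ‖G₁ - G₂‖ :=
      mul_le_mul_of_nonneg_right hMl (norm_nonneg _)
    exact mul_le_mul_of_nonneg_right (by simpa using this) (hw0 p).le
  set G := ContractingWith.fixedPoint Φ hΦ
  have hG : Φ G = G := hΦ.fixedPoint_isFixedPt
  refine ⟨wt G, hwt G, fun α β => ?_⟩
  have h1 : Φ G (α, β) = G (α, β) := by rw [hG]
  have h2 : (w (α, β) : ℂ) ≠ 0 := by exact_mod_cast (hw0 _).ne'
  rw [hΦa, div_eq_iff h2] at h1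
  rw [mul_comm] at h1
  exact h1.symm

/-- `H` solves `∂_α ∂_β H = Q (α + β) H` with `∂_β H = B` and data `H (α, 0) = g α`,
`∂_β H (0, β) = 0`; here `A = ∂_α H`. -/
structure IsGoursatSolution (Q g : ℝ → ℂ) (H A B : ℝ → ℝ → ℂ) : Prop where
  continuous_left : Continuous (uncurry A)
  continuous_right : Continuous (uncurry B)
  hasDerivAt_left : ∀ α β, HasDerivAt (fun α => H α β) (A α β) α
  hasDerivAt_right : ∀ α β, HasDerivAt (fun β => H α β) (B α β) β
  hasDerivAt_mixed : ∀ α β, HasDerivAt (fun α => B α β) (Q (α + β) * H α β) α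
  right_zero : ∀ α, H α 0 = g α
  deriv_zero : ∀ β, B 0 β = 0

theorem exists_isGoursatSolution {Q : ℝ → ℂ} (hQ : Continuous Q) {M : ℝ} (hM : ∀ x, ‖Q x‖ ≤ M)
    {g g' : ℝ → ℂ} (hg' : Continuous g') (hg : ∀ x, HasDerivAt g (g' x) x)
    (hgr : ∀ l, 1 ≤ l → ∃ C, ∀ α, ‖g α‖ ≤ C * Real.cosh (l * α)) :
    ∃ H A B : ℝ → ℝ → ℂ, IsGoursatSolution Q g H A B := by
  have hgc : Continuous g := continuous_iff_continuousAt.2 fun x => (hg x).continuousAt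
  obtain ⟨H, hH, hHe⟩ := exists_goursat hQ hM hgc hgr
  have hF : Continuous (uncurry fun s r => Q (s + r) * H s r) :=
    (hQ.comp (continuous_fst.add continuous_snd)).mul hH
  have hFs : Continuous (uncurry fun r s => Q (s + r) * H s r) := hF.comp continuous_swap
  have hI : Continuous (uncurry fun s β => ∫ r in (0 : ℝ)..β, Q (s + r) * H s r) :=
    continuous_integral_of_continuous hF 0
  have hJ : Continuous (uncurry fun β α => ∫ s in (0 : ℝ)..α, Q (s + β) * H s β) :=
    continuous_integral_of_continuous hFs 0
  refine ⟨H, fun α β => g' α + ∫ r in (0 : ℝ)..β, Q (α + r) * H α r,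
    fun α β => ∫ s in (0 : ℝ)..α, Q (s + β) * H s β, ?_, hJ.comp continuous_swap,
    ?_, ?_, ?_, ?_, ?_⟩
  · exact (hg'.comp continuous_fst).add hI
  · intro α β
    have h1 : (fun α => H α β) = fun α => g α + goursatInt Q H α β := funext fun α => hHe α β
    rw [h1]
    exact (hg α).add
      ((hI.comp (Continuous.prodMk_left β)).integral_hasStrictDerivAt 0 α).hasDerivAt
  · intro α β
    have h1 : (fun β => H α β) = fun β => g α + goursatInt Q H α β := funext fun β => hHe α β
    rw [h1]
    refine HasDerivAt.const_add _ (hasDerivAt_integral_of_continuous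
      (F := fun β s => ∫ r in (0 : ℝ)..β, Q (s + r) * H s r)
      (F' := fun β s => Q (s + β) * H s β) (hI.comp continuous_swap) hFs (fun β s => ?_) 0 α β)
    exact ((hF.comp (Continuous.prodMk_right s)).integral_hasStrictDerivAt 0 β).hasDerivAt
  · intro α β
    exact ((hF.comp (Continuous.prodMk_left β)).integral_hasStrictDerivAt 0 α).hasDerivAt
  · intro α
    rw [hHe]
    simp [goursatInt]
  · intro β
    simp

end

/-! ### Existence of a transmutation kernel -/

section

open Set Function

lemma continuous_apply₂ {X : Type*} [TopologicalSpace X] {H : ℝ → ℝ → ℂ}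
    (hH : Continuous (uncurry H)) {a b : X → ℝ} (ha : Continuous a) (hb : Continuous b) :
    Continuous fun x => H (a x) (b x) :=
  hH.comp (ha.prodMk hb)

/-- For `K(x, t) = H((x + t) / 2, (x - t) / 2)`, half of the integral `∫_{-x}^{x} K(x, t) v(t) dt`,
written in the characteristic coordinate `α = (x + t) / 2`. -/
noncomputable def charIntLeft (H : ℝ → ℝ → ℂ) (v : ℝ → ℂ) (x : ℝ) : ℂ :=
  ∫ a in (0 : ℝ)..x, H a (x - a) * v (2 * a - x)

/-- The same integral as `charIntLeft`, in the characteristic coordinate `β = (x - t) / 2`. -/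
noncomputable def charIntRight (H : ℝ → ℝ → ℂ) (v : ℝ → ℂ) (x : ℝ) : ℂ :=
  ∫ r in (0 : ℝ)..x, H (x - r) r * v (x - 2 * r)

lemma charIntLeft_eq_charIntRight (H : ℝ → ℝ → ℂ) (v : ℝ → ℂ) (x : ℝ) :
    charIntLeft H v x = charIntRight H v x := by
  have h := intervalIntegral.integral_comp_sub_left (a := 0) (b := x)
    (fun a => H a (x - a) * v (2 * a - x)) x
  simp only [sub_self, sub_zero] at h
  rw [charIntLeft, ← h, charIntRight]
  refine intervalIntegral.integral_congr fun r _ => ?_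
  congr 2 <;> ring

lemma continuous_charIntLeft {H : ℝ → ℝ → ℂ} (hH : Continuous (uncurry H)) {v : ℝ → ℂ}
    (hv : Continuous v) : Continuous (charIntLeft H v) :=
  (continuous_integral_of_continuous (F := fun x a => H a (x - a) * v (2 * a - x))
    ((continuous_apply₂ hH (a := fun p : ℝ × ℝ => p.2) (b := fun p => p.1 - p.2)
      (by fun_prop) (by fun_prop)).mul (hv.comp (by fun_prop))) 0).comp
    (continuous_id.prodMk continuous_id)

namespace IsGoursatSolution

variable {Q g : ℝ → ℂ} {H A B : ℝ → ℝ → ℂ}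

lemma contDiff (hS : IsGoursatSolution Q g H A B) : ContDiff ℝ 1 (uncurry H) :=
  contDiff_one_of_partial hS.continuous_left hS.continuous_right hS.hasDerivAt_left
    hS.hasDerivAt_right

lemma hasDerivAt_charIntLeft (hS : IsGoursatSolution Q g H A B) {v v' : ℝ → ℂ}
    (hv : ∀ x, HasDerivAt v (v' x) x) (hv' : Continuous v') (x : ℝ) :
    HasDerivAt (charIntLeft H v) (g x * v x + charIntLeft B v x - charIntLeft H v' x) x := by
  have hvc : Continuous v := continuous_iff_continuousAt.2 fun x => (hv x).continuousAt
  have hH := hS.contDiff.continuous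
  have c1 : ∀ {G : ℝ → ℝ → ℂ} {w : ℝ → ℂ}, Continuous (uncurry G) → Continuous w →
      Continuous (uncurry fun x a => G a (x - a) * w (2 * a - x)) := fun hG hw =>
    (continuous_apply₂ hG (a := fun p : ℝ × ℝ => p.2) (b := fun p => p.1 - p.2)
      (by fun_prop) (by fun_prop)).mul (hw.comp (by fun_prop))
  have h := hasDerivAt_integral_diag (F := fun x a => H a (x - a) * v (2 * a - x))
    (F' := fun x a => B a (x - a) * v (2 * a - x) - H a (x - a) * v' (2 * a - x))
    (c1 hH hvc) ((c1 hS.continuous_right hvc).sub (c1 hH hv')) (fun x a => by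
      have e1 : HasDerivAt (fun x => H a (x - a)) (B a (x - a)) x := by
        simpa using HasDerivAt.comp_sub_const x a (hS.hasDerivAt_right a (x - a))
      have e2 : HasDerivAt (fun x => v (2 * a - x)) (-v' (2 * a - x)) x :=
        HasDerivAt.comp_const_sub (2 * a) x (hv (2 * a - x))
      convert! e1.mul e2 using 1
      ring) x
  convert! h using 1
  have s : ∀ {G : ℝ → ℝ → ℂ} {w : ℝ → ℂ}, Continuous (uncurry G) → Continuous w →
      IntervalIntegrable (fun a => G a (x - a) * w (2 * a - x)) MeasureTheory.volume 0 x :=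
    fun hG hw => ((c1 hG hw).comp (Continuous.prodMk_right x)).intervalIntegrable _ _
  rw [intervalIntegral.integral_sub (s hS.continuous_right hvc) (s hH hv'), sub_self,
    hS.right_zero, show 2 * x - x = x by ring]
  simp only [charIntLeft]
  ring

/-- In the coordinate `β` only the mixed derivative `∂_α B = Q H` occurs. -/
lemma hasDerivAt_charIntRight (hS : IsGoursatSolution Q g H A B) (hQ : Continuous Q) {v v' : ℝ → ℂ}
    (hv : ∀ x, HasDerivAt v (v' x) x) (hv' : Continuous v') (x : ℝ) :
    HasDerivAt (charIntRight B v) (Q x * charIntRight H v x + charIntRight B v' x) x := by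
  have hvc : Continuous v := continuous_iff_continuousAt.2 fun x => (hv x).continuousAt
  have hH := hS.contDiff.continuous
  have c1 : ∀ {G : ℝ → ℝ → ℂ} {w : ℝ → ℂ}, Continuous (uncurry G) → Continuous w →
      Continuous (uncurry fun x r => G (x - r) r * w (x - 2 * r)) := fun hG hw =>
    (continuous_apply₂ hG (a := fun p : ℝ × ℝ => p.1 - p.2) (b := fun p => p.2)
      (by fun_prop) (by fun_prop)).mul (hw.comp (by fun_prop))
  have h := hasDerivAt_integral_diag (F := fun x r => B (x - r) r * v (x - 2 * r))
    (F' := fun x r => Q x * (H (x - r) r * v (x - 2 * r)) + B (x - r) r * v' (x - 2 * r))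
    (c1 hS.continuous_right hvc)
    (((hQ.comp continuous_fst).mul (c1 hH hvc)).add (c1 hS.continuous_right hv')) (fun x r => by
      have e1 : HasDerivAt (fun x => B (x - r) r) (Q x * H (x - r) r) x := by
        simpa using HasDerivAt.comp_sub_const x r (hS.hasDerivAt_mixed (x - r) r)
      have e2 : HasDerivAt (fun x => v (x - 2 * r)) (v' (x - 2 * r)) x :=
        HasDerivAt.comp_sub_const x (2 * r) (hv (x - 2 * r))
      convert! e1.mul e2 using 1
      ring) x
  convert! h using 1
  have s : ∀ {G : ℝ → ℝ → ℂ} {w : ℝ → ℂ}, Continuous (uncurry G) → Continuous w →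
      IntervalIntegrable (fun r => G (x - r) r * w (x - 2 * r)) MeasureTheory.volume 0 x :=
    fun hG hw => ((c1 hG hw).comp (Continuous.prodMk_right x)).intervalIntegrable _ _
  rw [intervalIntegral.integral_add ((s hH hvc).const_mul _) (s hS.continuous_right hv'), sub_self,
    hS.deriv_zero, intervalIntegral.integral_const_mul]
  simp only [charIntRight]
  ring

/-- The second derivative of `∫ K(x, t) u(t) dt`. The terms with `u'` cancel, and the derivative of
the boundary value `H (x, 0) = g x` produces `Q u`. -/
lemma hasDerivAt_two_charIntLeft (hS : IsGoursatSolution Q g H A B) (hQ : Continuous Q)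
    (hg : ∀ x, HasDerivAt g (Q x / 2) x) {u u1 u2 : ℝ → ℂ} (h1 : ∀ x, HasDerivAt u (u1 x) x)
    (h2 : ∀ x, HasDerivAt u1 (u2 x) x) (hc : Continuous u2) (x : ℝ) :
    HasDerivAt (fun x => g x * u x + charIntLeft B u x - charIntLeft H u1 x)
      (Q x / 2 * u x + Q x * charIntLeft H u x + charIntLeft H u2 x) x := by
  have hc1 : Continuous u1 := continuous_iff_continuousAt.2 fun x => (h2 x).continuousAt
  have e1 := (hg x).mul (h1 x)
  have e2 := hS.hasDerivAt_charIntRight hQ h1 hc1 x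
  have e3 := hS.hasDerivAt_charIntLeft h2 hc x
  have e4 : charIntLeft B u = charIntRight B u := funext (charIntLeft_eq_charIntRight B u)
  rw [← charIntLeft_eq_charIntRight, ← charIntLeft_eq_charIntRight, ← e4] at e2
  convert! (e1.add e2).sub e3 using 1
  ring

end IsGoursatSolution

/-- The kernel `K(x, t) = H((x + t) / 2, (x - t) / 2)`. -/
noncomputable def goursatKernel (H : ℝ → ℝ → ℂ) (x t : ℝ) : ℂ :=
  H ((x + t) / 2) ((x - t) / 2)

lemma volterraOp_goursatKernel (H : ℝ → ℝ → ℂ) (v : ℝ → ℂ) (x : ℝ) :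
    volterraOp (goursatKernel H) v x = v x + 2 * charIntLeft H v x := by
  have h := intervalIntegral.smul_integral_comp_mul_sub (a := 0) (b := x)
    (fun t => goursatKernel H x t * v t) 2 x
  rw [show 2 * 0 - x = -x by ring, show 2 * x - x = x by ring] at h
  rw [volterraOp, ← h, charIntLeft, Complex.real_smul]
  push_cast
  congr 2
  refine intervalIntegral.integral_congr fun a _ => ?_
  simp only [goursatKernel]
  congr 2 <;> ring

lemma volterraOp_congr {K : ℝ → ℝ → ℂ} {u v : ℝ → ℂ} {b x : ℝ} (h : EqOn u v (Icc (-b) b))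
    (hx : x ∈ Icc (-b) b) : volterraOp K u x = volterraOp K v x := by
  rw [volterraOp, volterraOp, h hx]
  congr 1
  refine intervalIntegral.integral_congr fun t ht => ?_
  have ht' : t ∈ Icc (-b) b := uIcc_subset_Icc ⟨by linarith [hx.2], by linarith [hx.1]⟩ hx ht
  simp only [h ht']

/-- Uniqueness for the initial value problem of `y'' = Q y`. -/
lemma eqOn_of_secondOrder_ode {Q : ℝ → ℂ} {M b : ℝ} (hM : ∀ x, ‖Q x‖ ≤ M) (hb : 0 < b)
    {W W1 F F1 : ℝ → ℂ} (hW : ∀ x, HasDerivAt W (W1 x) x)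
    (hW1 : ∀ x, HasDerivAt W1 (Q x * W x) x) (hF : ∀ x, HasDerivAt F (F1 x) x) {F2 : ℝ → ℂ}
    (hF1 : ∀ x, HasDerivAt F1 (F2 x) x) (hF2 : ∀ x ∈ Icc (-b) b, F2 x = Q x * F x)
    (h0 : W 0 = F 0) (h1 : W1 0 = F1 0) : EqOn W F (Icc (-b) b) := by
  have hM0 : 0 ≤ M := (norm_nonneg _).trans (hM 0)
  have h := ODE_solution_unique_of_mem_Icc (a := -b) (b := b) (t₀ := 0) (s := fun _ => univ)
    (v := fun t (p : ℂ × ℂ) => (p.2, Q t * p.1)) (K := ⟨max 1 M, le_max_of_le_left zero_le_one⟩)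
    (f := fun x => (W x, W1 x)) (g := fun x => (F x, F1 x))
    (fun t _ => LipschitzWith.lipschitzOnWith (LipschitzWith.of_dist_le_mul fun p r => by
      have hp1 : dist p.1 r.1 ≤ dist p r := le_max_left _ _
      have hp2 : dist p.2 r.2 ≤ dist p r := le_max_right _ _
      refine max_le ?_ ?_
      · exact hp2.trans (le_mul_of_one_le_left dist_nonneg (le_max_left 1 M))
      · rw [dist_eq_norm, ← mul_sub, norm_mul, ← dist_eq_norm]
        exact mul_le_mul ((hM t).trans (le_max_right 1 M)) hp1 dist_nonneg
          (le_max_of_le_left zero_le_one)))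
    ⟨by linarith, hb⟩
    (fun x _ => ((hW x).prodMk (hW1 x)).continuousAt.continuousWithinAt)
    (fun x _ => (hW x).prodMk (hW1 x)) (fun _ _ => mem_univ _)
    (fun x _ => ((hF x).prodMk (hF1 x)).continuousAt.continuousWithinAt)
    (fun x hx => by
      have := (hF x).prodMk (hF1 x)
      rwa [hF2 x (Ioo_subset_Icc_self hx)] at this) (fun _ _ => mem_univ _)
    (by simp [h0, h1])
  exact fun x hx => congrArg Prod.fst (h hx)

theorem exists_isTransmutationKernel {b : ℝ} (hb : 0 < b) {q : ℝ → ℂ}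
    (hq : ContinuousOn q (Icc (-b) b)) {f : ℝ → ℂ} (hf : IsSolution b q f) (hf0 : f 0 = 1) :
    ∃ K : ℝ → ℝ → ℂ, IsTransmutationKernel b q f K := by
  have hbb : -b < b := by linarith
  have h0m : (0 : ℝ) ∈ Icc (-b) b := ⟨by linarith, hb.le⟩
  obtain ⟨F, F1, F2, hF2, hdF, hdF1, hfF⟩ := exists_hasDerivAt_two_extension hbb hf.contDiffOn
  set Q : ℝ → ℂ := IccExtend hbb.le ((Icc (-b) b).domRestrict q) with hQdef
  have hQ : Continuous Q := (continuousOn_iff_continuous_domRestrict.1 hq).Icc_extend'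
  have hQq : EqOn Q q (Icc (-b) b) := fun x hx => by
    rw [hQdef, IccExtend_of_mem _ _ hx, domRestrict_apply]
  obtain ⟨M, hM'⟩ := isCompact_Icc.exists_bound_of_continuousOn hq
  have hM : ∀ x, ‖Q x‖ ≤ M := fun x => hM' _ (projIcc (-b) b hbb.le x).2
  have hM0 : 0 ≤ M := (norm_nonneg _).trans (hM 0)
  set g : ℝ → ℂ := fun x => F1 0 / 2 + ∫ t in (0 : ℝ)..x, Q t / 2 with hgdef
  have hQ2 : Continuous fun t => Q t / 2 := hQ.div_const 2
  have hg : ∀ x, HasDerivAt g (Q x / 2) x := hasDerivAt_const_add_integral hQ2 _ 0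
  have hgr : ∀ l, 1 ≤ l → ∃ C, ∀ α, ‖g α‖ ≤ C * Real.cosh (l * α) := by
    intro l hl
    refine ⟨‖F1 0 / 2‖ + M / l, fun α => ?_⟩
    have h1 := norm_integral_le_cosh (φ := fun t => Q t / 2) (D := M) (l := l) (by linarith) hM0
      (fun s => by
        have := Real.one_le_cosh (l * s)
        rw [norm_div]
        norm_num
        nlinarith [hM s, norm_nonneg (Q s)]) α
    refine (norm_add_le _ _).trans ?_
    rw [add_mul]
    exact add_le_add (le_mul_of_one_le_right (norm_nonneg _) (Real.one_le_cosh _)) h1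
  obtain ⟨H, A, B, hS⟩ := exists_isGoursatSolution hQ hM hQ2 hg hgr
  have hH := hS.contDiff.continuous
  -- first and second derivatives of `T u` on the whole line
  have key1 : ∀ {u u1 : ℝ → ℂ}, (∀ x, HasDerivAt u (u1 x) x) → Continuous u1 → ∀ x,
      HasDerivAt (volterraOp (goursatKernel H) u)
        (u1 x + 2 * (g x * u x + charIntLeft B u x - charIntLeft H u1 x)) x := by
    intro u u1 h1 hc x
    rw [funext (volterraOp_goursatKernel H u)]
    exact (h1 x).add ((hS.hasDerivAt_charIntLeft h1 hc x).const_mul 2)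
  have key2 : ∀ {u u1 u2 : ℝ → ℂ}, (∀ x, HasDerivAt u (u1 x) x) →
      (∀ x, HasDerivAt u1 (u2 x) x) → Continuous u2 → ∀ x,
      HasDerivAt (fun x => u1 x + 2 * (g x * u x + charIntLeft B u x - charIntLeft H u1 x))
        (Q x * volterraOp (goursatKernel H) u x + volterraOp (goursatKernel H) u2 x) x := by
    intro u u1 u2 h1 h2 hc x
    convert! (h2 x).add ((hS.hasDerivAt_two_charIntLeft hQ hg h1 h2 hc x).const_mul 2) using 1
    rw [volterraOp_goursatKernel, volterraOp_goursatKernel]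
    ring
  have keyc : ∀ {u : ℝ → ℂ}, Continuous u → Continuous (volterraOp (goursatKernel H) u) := by
    intro u hu
    rw [funext (volterraOp_goursatKernel H u)]
    exact hu.add (continuous_const.mul (continuous_charIntLeft hH hu))
  refine ⟨goursatKernel H, ?_, ?_, ?_, ?_⟩
  · have : uncurry (goursatKernel H) =
        uncurry H ∘ fun p : ℝ × ℝ => ((p.1 + p.2) / 2, (p.1 - p.2) / 2) := rfl
    rw [this]
    exact (hS.contDiff.comp (by fun_prop)).contDiffOn
  · intro u hu
    obtain ⟨U, U1, U2, hU2, hdU, hdU1, huU⟩ := exists_hasDerivAt_two_extension hbb hu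
    have hU1c : Continuous U1 := continuous_iff_continuousAt.2 fun x => (hdU1 x).continuousAt
    have hUc : Continuous U := continuous_iff_continuousAt.2 fun x => (hdU x).continuousAt
    exact contDiffOn_two_of_eqOn (key1 hdU hU1c) (key2 hdU hdU1 hU2)
      ((hQ.mul (keyc hUc)).add (keyc hU2)) fun x hx => volterraOp_congr huU hx
  · intro u hu x hx
    obtain ⟨U, U1, U2, hU2, hdU, hdU1, huU⟩ := exists_hasDerivAt_two_extension hbb hu
    have hU1c : Continuous U1 := continuous_iff_continuousAt.2 fun x => (hdU1 x).continuousAt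
    rw [iteratedDerivWithin_two_of_eqOn hbb (key1 hdU hU1c) (key2 hdU hdU1 hU2)
      (fun y hy => volterraOp_congr huU hy) hx, volterraOp_congr huU hx,
      volterraOp_congr (u := fun t => -iteratedDerivWithin 2 u (Icc (-b) b) t)
        (v := fun t => -U2 t)
        (fun t ht => by simp only [iteratedDerivWithin_two_of_eqOn hbb hdU hdU1 huU ht]) hx, hQq hx]
    simp only [volterraOp, mul_neg, intervalIntegral.integral_neg]
    ring
  · intro x hx
    have hz : ∀ x, volterraOp (goursatKernel H) (fun _ => 0) x = 0 := fun x => by simp [volterraOp]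
    have e1 := key1 (u := fun _ => 1) (u1 := fun _ => 0) (fun x => hasDerivAt_const x 1)
      continuous_const
    have e2 := key2 (u := fun _ => 1) (u1 := fun _ => 0) (u2 := fun _ => 0)
      (fun x => hasDerivAt_const x 1) (fun x => hasDerivAt_const x 0) continuous_const
    simp only [hz, add_zero] at e2
    rw [hfF hx]
    refine eqOn_of_secondOrder_ode hM hb e1 e2 hdF hdF1 (fun y hy => ?_) ?_ ?_ hx
    · rw [← iteratedDerivWithin_two_of_eqOn hbb hdF hdF1 hfF hy, hf.ode y hy, hQq hy, hfF hy]
    · rw [← hfF h0m, hf0]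
      simp [volterraOp]
    · simp [charIntLeft, hgdef]
      ring

end

/-! ### Images of powers under a transmutation operator -/

section

open Set Function

lemma hasDerivAt_ofReal_pow (k : ℕ) (x : ℝ) :
    HasDerivAt (fun t : ℝ => (t : ℂ) ^ k) ((k : ℂ) * (x : ℂ) ^ (k - 1)) x := by
  simpa using (Complex.ofRealCLM.hasDerivAt (x := x)).fun_pow k

lemma volterraOp_const_mul (K : ℝ → ℝ → ℂ) (c : ℂ) (u : ℝ → ℂ) (x : ℝ) :
    volterraOp K (fun t => c * u t) x = c * volterraOp K u x := by
  simp only [volterraOp, mul_left_comm _ c, intervalIntegral.integral_const_mul, mul_add]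

section

variable {b : ℝ} {q f : ℝ → ℂ} {K : ℝ → ℝ → ℂ}

/-- The equation `w'' = q w + k (k - 1) T[t ^ (k - 2)]` for `w = T[t ^ k]`. -/
lemma IsTransmutationKernel.iteratedDerivWithin_pow (hb : 0 < b)
    (hK : IsTransmutationKernel b q f K) (k : ℕ) {x : ℝ} (hx : x ∈ Icc (-b) b) :
    iteratedDerivWithin 2 (volterraOp K fun t => (t : ℂ) ^ k) (Icc (-b) b) x =
      q x * volterraOp K (fun t => (t : ℂ) ^ k) x +
        (k : ℂ) * ((k - 1 : ℕ) : ℂ) * volterraOp K (fun t => (t : ℂ) ^ (k - 2)) x := by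
  have hbb : -b < b := by linarith
  have hd2 : ∀ x : ℝ, HasDerivAt (fun t : ℝ => (k : ℂ) * (t : ℂ) ^ (k - 1))
      ((k : ℂ) * (((k - 1 : ℕ) : ℂ) * (x : ℂ) ^ (k - 2))) x := fun x =>
    (hasDerivAt_ofReal_pow (k - 1) x).const_mul _
  have h := hK.intertwine (fun t => (t : ℂ) ^ k)
    (contDiffOn_two_of_eqOn (hasDerivAt_ofReal_pow k) hd2 (by fun_prop) fun _ _ => rfl) x hx
  rw [volterraOp_congr (u := fun t => -iteratedDerivWithin 2 (fun t : ℝ => (t : ℂ) ^ k)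
      (Icc (-b) b) t) (v := fun t => -((k : ℂ) * ((k - 1 : ℕ) : ℂ)) * (t : ℂ) ^ (k - 2))
      (fun t ht => by
        simp only [iteratedDerivWithin_two_of_eqOn hbb (hasDerivAt_ofReal_pow k) hd2
          (fun _ _ => rfl) ht]
        ring) hx, volterraOp_const_mul] at h
  linear_combination -h

/-- `T[t ^ k] - t ^ k` vanishes to second order at `0` when `k ≥ 1`. -/
lemma IsTransmutationKernel.hasDerivAt_pow_zero (hb : 0 < b)
    (hK : IsTransmutationKernel b q f K) (k : ℕ) :
    HasDerivAt (volterraOp K fun t => (t : ℂ) ^ (k + 1)) (if k = 0 then 1 else 0) 0 := by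
  obtain ⟨C, hC⟩ := ((isCompact_Icc (a := -b) (b := b)).prod
    (isCompact_Icc (a := -b) (b := b))).exists_bound_of_continuousOn hK.contDiffOn.continuousOn
  have h0m : (0 : ℝ) ∈ Icc (-b) b := ⟨by linarith, hb.le⟩
  have hC0 : 0 ≤ C := (norm_nonneg _).trans (hC (0, 0) ⟨h0m, h0m⟩)
  have h1 : (fun x : ℝ => ∫ t in (-x)..x, K x t * (t : ℂ) ^ (k + 1)) =O[nhds 0]
      fun x => ‖x - 0‖ ^ 2 := by
    refine Asymptotics.IsBigO.of_bound (C * b ^ k * 2) ?_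
    filter_upwards [Icc_mem_nhds (show -b < 0 by linarith) hb] with x hx
    have hxb : |x| ≤ b := abs_le.2 hx
    have := intervalIntegral.norm_integral_le_of_norm_le_const (a := -x) (b := x)
      (f := fun t => K x t * (t : ℂ) ^ (k + 1)) (C := C * (b ^ k * |x|)) fun t ht => by
        have ht1 : t ∈ uIcc (-x) x := uIoc_subset_uIcc ht
        have ht2 : |t| ≤ |x| := by
          rcases le_total 0 x with h | h
          · rw [uIcc_of_le (by linarith)] at ht1
            rw [abs_of_nonneg h]
            exact abs_le.2 ht1
          · rw [uIcc_of_ge (by linarith)] at ht1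
            rw [abs_of_nonpos h]
            exact abs_le.2 ⟨by linarith [ht1.1], ht1.2⟩
        rw [norm_mul, norm_pow, Complex.norm_real, Real.norm_eq_abs, pow_succ]
        refine mul_le_mul (hC (x, t) ⟨hx, abs_le.1 (ht2.trans hxb)⟩) ?_ (by positivity) hC0
        exact mul_le_mul (pow_le_pow_left₀ (abs_nonneg _) (ht2.trans hxb) k) ht2 (abs_nonneg _)
          (by positivity)
    refine this.trans_eq ?_
    rw [show x - -x = 2 * x by ring, abs_mul, abs_two, sub_zero, Real.norm_eq_abs, Real.norm_eq_abs,
      abs_pow, abs_abs]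
    ring
  have h2 := (h1.hasFDerivAt one_lt_two).hasDerivAt
  have h3 := (hasDerivAt_ofReal_pow (k + 1) 0).add h2
  convert! h3 using 1
  rcases k with _ | k <;> simp

/-- Integrating the Wronskian: if `F W' - F' W = k Z` and `W 0 = 0`, then `W = F ∫ k Z F⁻²`. -/
lemma eq_mul_integral_of_wronskian {F F1 W W1 Z : ℝ → ℂ} {k : ℂ}
    (hF : ∀ x, HasDerivAt F (F1 x) x) (hF1 : Continuous F1) (hW : ∀ x, HasDerivAt W (W1 x) x)
    (hW1 : Continuous W1) (hne : ∀ x ∈ Icc 0 b, F x ≠ 0) (h0 : W 0 = 0)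
    (hZ : ∀ x ∈ Icc 0 b, F x * W1 x - F1 x * W x = k * Z x) {x : ℝ} (hx : x ∈ Icc 0 b) :
    W x = F x * (k * ∫ s in (0 : ℝ)..x, Z s * (F s ^ 2)⁻¹) := by
  have hFc : Continuous F := continuous_iff_continuousAt.2 fun x => (hF x).continuousAt
  have hWc : Continuous W := continuous_iff_continuousAt.2 fun x => (hW x).continuousAt
  have hsub : uIcc 0 x ⊆ Icc 0 b := by
    rw [uIcc_of_le hx.1]
    exact Icc_subset_Icc_right hx.2
  have h := intervalIntegral.integral_eq_sub_of_hasDerivAt (a := 0) (b := x)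
    (f := fun s => W s / F s) (f' := fun s => (W1 s * F s - W s * F1 s) / F s ^ 2)
    (fun s hs => (hW s).div (hF s) (hne s (hsub hs)))
    (ContinuousOn.intervalIntegrable (ContinuousOn.div (by fun_prop) (by fun_prop)
      fun s hs => pow_ne_zero 2 (hne s (hsub hs))))
  have h2 : ∫ s in (0 : ℝ)..x, (W1 s * F s - W s * F1 s) / F s ^ 2 =
      ∫ s in (0 : ℝ)..x, k * (Z s * (F s ^ 2)⁻¹) := by
    refine intervalIntegral.integral_congr fun s hs => ?_
    rw [div_eq_mul_inv, ← mul_assoc, ← hZ s (hsub hs)]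
    ring
  rw [h2, intervalIntegral.integral_const_mul, h0, zero_div, sub_zero] at h
  rw [h, mul_div_cancel₀ _ (hne x hx)]

/-- A transmutation operator maps `t ^ k` to the formal power `φ_k` on `[0, b]`. -/
theorem IsTransmutationKernel.volterraOp_pow_eq_formalPower (hb : 0 < b) (hf : IsSolution b q f)
    (hf0 : f 0 = 1) (hfne : ∀ x ∈ Icc 0 b, f x ≠ 0) (hK : IsTransmutationKernel b q f K) (k : ℕ)
    {x : ℝ} (hx : x ∈ Icc 0 b) :
    volterraOp K (fun t => (t : ℂ) ^ k) x = formalPower f k x := by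
  have hbb : -b < b := by linarith
  have hsub : Icc 0 b ⊆ Icc (-b) b := Icc_subset_Icc_left (by linarith)
  have h0m : (0 : ℝ) ∈ Icc (-b) b := ⟨by linarith, hb.le⟩
  obtain ⟨F, F1, F2, hF2, hdF, hdF1, hfF⟩ := exists_hasDerivAt_two_extension hbb hf.contDiffOn
  have hF1c : Continuous F1 := continuous_iff_continuousAt.2 fun x => (hdF1 x).continuousAt
  have hFc : Continuous F := continuous_iff_continuousAt.2 fun x => (hdF x).continuousAt
  have hF2q : ∀ y ∈ Icc (-b) b, F2 y = q y * F y := fun y hy => by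
    rw [← iteratedDerivWithin_two_of_eqOn hbb hdF hdF1 hfF hy, hf.ode y hy, hfF hy]
  have hF0 : F 0 = 1 := by rw [← hfF h0m, hf0]
  have hFne : ∀ y ∈ Icc 0 b, F y ≠ 0 := fun y hy => by
    rw [← hfF (hsub hy)]
    exact hfne y hy
  have hint : ∀ (Y : ℝ → ℂ) (m : ℤ) {y : ℝ}, y ∈ Icc 0 b →
      ∫ s in (0 : ℝ)..y, Y s * (f s ^ 2) ^ m = ∫ s in (0 : ℝ)..y, Y s * (F s ^ 2) ^ m := by
    intro Y m y hy
    refine intervalIntegral.integral_congr fun s hs => ?_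
    rw [uIcc_of_le hy.1] at hs
    simp only [hfF (hsub ⟨hs.1, hs.2.trans hy.2⟩)]
  -- the Wronskian of `f` and `T[t ^ (k + 1)]`
  have hwr : ∀ k : ℕ, ∃ W W1 : ℝ → ℂ, (∀ y, HasDerivAt W (W1 y) y) ∧ Continuous W1 ∧
      EqOn (volterraOp K fun t => (t : ℂ) ^ (k + 1)) W (Icc (-b) b) ∧ W 0 = 0 ∧
      ∀ y ∈ Icc 0 b, F y * W1 y - F1 y * W y = (if k = 0 then 1 else 0) +
        ∫ s in (0 : ℝ)..y,
          F s * (((k : ℂ) + 1) * k * volterraOp K (fun t => (t : ℂ) ^ (k - 1)) s) := by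
    intro k
    have hKc : ContDiffOn ℝ 2 (volterraOp K fun t => (t : ℂ) ^ (k + 1)) (Icc (-b) b) :=
      hK.map_contDiffOn _ ((Complex.ofRealCLM.contDiff.pow (k + 1)).contDiffOn)
    obtain ⟨W, W1, W2, hW2, hdW, hdW1, hwW⟩ := exists_hasDerivAt_two_extension hbb hKc
    have hW1c : Continuous W1 := continuous_iff_continuousAt.2 fun x => (hdW1 x).continuousAt
    have hWc : Continuous W := continuous_iff_continuousAt.2 fun x => (hdW x).continuousAt
    have hW0 : W 0 = 0 := by
      rw [← hwW h0m]
      simp [volterraOp]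
    have hW10 : W1 0 = if k = 0 then 1 else 0 :=
      (hdW 0).unique ((hK.hasDerivAt_pow_zero hb k).congr_of_eventuallyEq
        ((Filter.eventually_of_mem (Icc_mem_nhds (by linarith) hb) fun y hy => hwW hy).mono
          fun y hy => hy.symm))
    refine ⟨W, W1, hdW, hW1c, hwW, hW0, fun y hy => ?_⟩
    have h := intervalIntegral.integral_eq_sub_of_hasDerivAt (a := 0) (b := y)
      (f := fun s => F s * W1 s - F1 s * W s) (f' := fun s => F s * W2 s - F2 s * W s)
      (fun s _ => by
        convert! ((hdF s).mul (hdW1 s)).sub ((hdF1 s).mul (hdW s)) using 1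
        ring) (Continuous.intervalIntegrable (by fun_prop) _ _)
    have h2 : ∫ s in (0 : ℝ)..y, (F s * W2 s - F2 s * W s) = ∫ s in (0 : ℝ)..y,
        F s * (((k : ℂ) + 1) * k * volterraOp K (fun t => (t : ℂ) ^ (k - 1)) s) := by
      refine intervalIntegral.integral_congr fun s hs => ?_
      rw [uIcc_of_le hy.1] at hs
      have hs' : s ∈ Icc (-b) b := hsub ⟨hs.1, hs.2.trans hy.2⟩
      have h3 := hK.iteratedDerivWithin_pow hb (k + 1) hs'
      rw [iteratedDerivWithin_two_of_eqOn hbb hdW hdW1 hwW hs', hwW hs'] at h3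
      simp only [Nat.add_sub_cancel, show k + 1 - 2 = k - 1 by omega] at h3
      simp only [h3, hF2q s hs']
      push_cast
      ring
    rw [h2, hF0, hW0, hW10] at h
    rw [h]
    ring
  induction k using Nat.strong_induction_on generalizing x with
  | _ k ih =>
    rcases k with _ | _ | k
    · simpa [formalPower, recXTilde] using hK.map_one x (hsub hx)
    · obtain ⟨W, W1, hdW, hW1c, hwW, hW0, hwr⟩ := hwr 0
      have h := eq_mul_integral_of_wronskian hdF hF1c hdW hW1c hFne hW0 (Z := fun _ => 1) (k := 1)
        (fun y hy => by simpa using hwr y hy) hx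
      rw [hwW (hsub hx), h]
      have := hint (fun _ => 1) (-1) hx
      simp at this
      simp [formalPower, recX, hfF (hsub hx), this]
    · obtain ⟨W, W1, hdW, hW1c, hwW, hW0, hwr⟩ := hwr (k + 1)
      -- the functions `X` of the parity of `k`
      obtain ⟨Y, hY0, hY1, hY2⟩ : ∃ Y : ℕ → ℝ → ℂ,
          (∀ y, formalPower f k y = f y * Y k y) ∧
          (∀ y, Y (k + 1) y = ((k : ℂ) + 1) * ∫ s in (0 : ℝ)..y, Y k s * (f s ^ 2) ^ (1 : ℤ)) ∧
          (∀ y, formalPower f (k + 2) y =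
            f y * (((k : ℂ) + 2) * ∫ s in (0 : ℝ)..y, Y (k + 1) s * (f s ^ 2) ^ (-1 : ℤ))) := by
        rcases Nat.even_or_odd k with hk | hk
        · refine ⟨recXTilde f, fun y => ?_, fun y => ?_, fun y => ?_⟩
          · rw [formalPower, if_neg (Nat.not_odd_iff_even.2 hk)]
          · rw [recXTilde, hk.neg_one_pow]
            push_cast
            rfl
          · rw [formalPower, if_neg (Nat.not_odd_iff_even.2 (hk.add even_two)), recXTilde,
              hk.add_one.neg_one_pow]
            push_cast
            rw [show (k : ℂ) + 1 + 1 = k + 2 by ring]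
        · refine ⟨recX f, fun y => ?_, fun y => ?_, fun y => ?_⟩
          · rw [formalPower, if_pos hk]
          · rw [recX, hk.add_one.neg_one_pow]
            push_cast
            rfl
          · rw [formalPower, if_pos (hk.add_even even_two), recX,
              show k + 1 + 1 = k + 2 from rfl, (hk.add_even even_two).neg_one_pow]
            push_cast
            rfl
      have hwr' : ∀ y ∈ Icc 0 b, F y * W1 y - F1 y * W y = ((k : ℂ) + 2) * Y (k + 1) y := by
        intro y hy
        rw [hwr y hy, hY1, hint _ _ hy, if_neg (Nat.succ_ne_zero k), zero_add,
          ← intervalIntegral.integral_const_mul, ← intervalIntegral.integral_const_mul]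
        refine intervalIntegral.integral_congr fun s hs => ?_
        rw [uIcc_of_le hy.1] at hs
        have hs' : s ∈ Icc 0 b := ⟨hs.1, hs.2.trans hy.2⟩
        simp only [Nat.add_sub_cancel, ih k (by omega) hs', hY0, hfF (hsub hs'), zpow_one]
        push_cast
        ring
      have h := eq_mul_integral_of_wronskian hdF hF1c hdW hW1c hFne hW0 hwr' hx
      rw [hwW (hsub hx), h, hY2, hint _ _ hx, hfF (hsub hx)]
      simp

end

end

/-! ### Legendre coefficients of the kernel -/

section

open Set Function Polynomial

/-- The `n`-th Fourier–Legendre coefficient on `[-1, 1]` of a complex-valued function. -/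
noncomputable def legendreCoeffC (g : ℝ → ℂ) (n : ℕ) : ℂ :=
  (2 * (n : ℂ) + 1) / 2 * ∫ s in (-1 : ℝ)..1, g s * (((legendre n).eval s : ℝ) : ℂ)

lemma legendreMoment_eq_zero {j k : ℕ} (h : j % 2 ≠ k % 2) : legendreMoment j k = 0 := by
  have h1 := intervalIntegral.integral_comp_neg (a := -1) (b := 1)
    (fun y : ℝ => (legendre j).eval y * y ^ k)
  rw [neg_neg] at h1
  have h2 : ∀ y : ℝ, (legendre j).eval (-y) * (-y) ^ k = -((legendre j).eval y * y ^ k) := by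
    intro y
    have h3 : (-1 : ℝ) ^ j * (-1) ^ k = -1 := by
      rw [← pow_add]
      exact Odd.neg_one_pow (Nat.odd_iff.2 (by omega))
    rw [legendre_eval_neg, neg_pow y]
    linear_combination ((legendre j).eval y * y ^ k) * h3
  simp_rw [h2, intervalIntegral.integral_neg] at h1
  rw [legendreMoment]
  linarith

/-- Up to the leading coefficient of `P_k`, the moment `p_{k,k}` is `∫ P_k²`. -/
lemma legendreMoment_self_ne_zero (k : ℕ) : legendreMoment k k ≠ 0 := by
  have hd : (legendre k - C ((legendre k).coeff k) * X ^ k).degree < (k : WithBot ℕ) :=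
    degree_sub_lt_of_coeff_eq (natDegree_legendre_le k)
      (natDegree_C_mul_X_pow_le _ _) (by simp)
  have h := integral_legendre_mul_of_degree_lt hd
  simp_rw [eval_sub, mul_sub] at h
  rw [intervalIntegral.integral_sub (Continuous.intervalIntegrable (by fun_prop) _ _)
    (Continuous.intervalIntegrable (by fun_prop) _ _), integral_legendre_sq] at h
  simp only [eval_mul, eval_C, eval_pow, eval_X, mul_left_comm _ ((legendre k).coeff k)] at h
  rw [intervalIntegral.integral_const_mul] at h
  intro h0
  rw [legendreMoment] at h0
  rw [h0] at h
  have : (0 : ℝ) < 2 / (2 * k + 1) := by positivity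
  linarith

lemma X_pow_eq_sum_legendre (k : ℕ) (s : ℝ) :
    s ^ k = ∑ j ∈ Finset.range (k + 1),
      (2 * j + 1) / 2 * legendreMoment j k * (legendre j).eval s := by
  have h := legendreProj_eval_of_degree_lt (p := X ^ k) (N := k + 1)
    (by rw [degree_X_pow]; exact_mod_cast Nat.lt_succ_self k)
  have h2 := congrArg (Polynomial.eval s) h
  rw [legendreProj, eval_finsetSum] at h2
  simp only [eval_pow, eval_X, eval_mul, eval_C] at h2
  rw [← h2]
  refine Finset.sum_congr rfl fun j _ => ?_
  simp only [legendreCoeff, legendreMoment, mul_comm (_ ^ k)]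

section

variable {g : ℝ → ℂ}

lemma integral_mul_pow_eq_sum_legendreCoeffC (hg : Continuous g) (k : ℕ) :
    ∫ s in (-1 : ℝ)..1, g s * (s : ℂ) ^ k =
      ∑ j ∈ Finset.range (k + 1), (legendreMoment j k : ℂ) * legendreCoeffC g j := by
  have h : ∀ s : ℝ, g s * (s : ℂ) ^ k = ∑ j ∈ Finset.range (k + 1),
      ((2 * (j : ℂ) + 1) / 2 * legendreMoment j k) * (g s * (((legendre j).eval s : ℝ) : ℂ)) := by
    intro s
    rw [← Complex.ofReal_pow, X_pow_eq_sum_legendre, Complex.ofReal_sum, Finset.mul_sum]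
    refine Finset.sum_congr rfl fun j _ => ?_
    push_cast
    ring
  simp_rw [h]
  rw [intervalIntegral.integral_finsetSum
    fun j _ => Continuous.intervalIntegrable (by fun_prop) _ _]
  refine Finset.sum_congr rfl fun j _ => ?_
  rw [intervalIntegral.integral_const_mul, legendreCoeffC]
  ring

lemma legendreCoeffC_eq_sum_moments (hg : Continuous g) (n : ℕ) :
    legendreCoeffC g n = (2 * (n : ℂ) + 1) / 2 * ∑ k ∈ Finset.range (n + 1),
      (((legendre n).coeff k : ℝ) : ℂ) * ∫ s in (-1 : ℝ)..1, g s * (s : ℂ) ^ k := by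
  have h : ∀ s : ℝ, g s * (((legendre n).eval s : ℝ) : ℂ) = ∑ k ∈ Finset.range (n + 1),
      (((legendre n).coeff k : ℝ) : ℂ) * (g s * (s : ℂ) ^ k) := by
    intro s
    rw [eval_eq_sum_range' (Nat.lt_succ_of_le (natDegree_legendre_le n)), Complex.ofReal_sum,
      Finset.mul_sum]
    refine Finset.sum_congr rfl fun j _ => ?_
    push_cast
    ring
  rw [legendreCoeffC]
  simp_rw [h]
  rw [intervalIntegral.integral_finsetSum
    fun j _ => Continuous.intervalIntegrable (by fun_prop) _ _]
  simp_rw [intervalIntegral.integral_const_mul]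

lemma re_legendreCoeffC (hg : Continuous g) (n : ℕ) :
    (legendreCoeffC g n).re = legendreCoeff (fun s => (g s).re) n := by
  have h := Complex.reCLM.intervalIntegral_comp_comm (μ := MeasureTheory.volume) (a := -1) (b := 1)
    (f := fun s : ℝ => g s * (((legendre n).eval s : ℝ) : ℂ))
    (Continuous.intervalIntegrable (by fun_prop) _ _)
  simp only [Complex.reCLM_apply, Complex.re_mul_ofReal] at h
  rw [legendreCoeff, h, legendreCoeffC,
    show (2 * (n : ℂ) + 1) / 2 = (((2 * n + 1) / 2 : ℝ) : ℂ) by push_cast; ring,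
    Complex.re_ofReal_mul]

lemma im_legendreCoeffC (hg : Continuous g) (n : ℕ) :
    (legendreCoeffC g n).im = legendreCoeff (fun s => (g s).im) n := by
  have h := Complex.imCLM.intervalIntegral_comp_comm (μ := MeasureTheory.volume) (a := -1) (b := 1)
    (f := fun s : ℝ => g s * (((legendre n).eval s : ℝ) : ℂ))
    (Continuous.intervalIntegrable (by fun_prop) _ _)
  simp only [Complex.imCLM_apply, Complex.im_mul_ofReal] at h
  rw [legendreCoeff, h, legendreCoeffC,
    show (2 * (n : ℂ) + 1) / 2 = (((2 * n + 1) / 2 : ℝ) : ℂ) by push_cast; ring,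
    Complex.im_ofReal_mul]

theorem tendstoUniformlyOn_sum_legendreCoeffC {g' : ℝ → ℂ} (hd : ∀ x, HasDerivAt g (g' x) x)
    (hc : Continuous g') :
    TendstoUniformlyOn (fun (N : ℕ) (s : ℝ) => ∑ j ∈ Finset.range N,
      legendreCoeffC g j * (((legendre j).eval s : ℝ) : ℂ)) g Filter.atTop (Icc (-1) 1) := by
  have hg : Continuous g := continuous_iff_continuousAt.2 fun x => (hd x).continuousAt
  have hre := tendstoUniformlyOn_legendreProj (g := fun s => (g s).re) (g' := fun s => (g' s).re)
    (fun x => Complex.reCLM.hasFDerivAt.comp_hasDerivAt x (hd x)) (Complex.continuous_re.comp hc)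
  have him := tendstoUniformlyOn_legendreProj (g := fun s => (g s).im) (g' := fun s => (g' s).im)
    (fun x => Complex.imCLM.hasFDerivAt.comp_hasDerivAt x (hd x)) (Complex.continuous_im.comp hc)
  rw [Metric.tendstoUniformlyOn_iff] at hre him ⊢
  intro ε hε
  filter_upwards [hre (ε / 2) (by positivity), him (ε / 2) (by positivity)] with N h1 h2 s hs
  have e1 := h1 s hs
  have e2 := h2 s hs
  rw [Real.dist_eq] at e1 e2
  rw [dist_eq_norm]
  refine (Complex.norm_le_abs_re_add_abs_im _).trans_lt ?_
  simp only [Complex.sub_re, Complex.sub_im, Complex.re_sum, Complex.im_sum, Complex.re_mul_ofReal,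
    Complex.im_mul_ofReal, re_legendreCoeffC hg, im_legendreCoeffC hg]
  simp only [legendreProj, eval_finsetSum, eval_mul, eval_C] at e1 e2
  linarith

/-- The recursion for `β` inverts the triangular relation between the moments of a function and its
Legendre coefficients. -/
lemma beta_eq_legendreCoeffC (hg : Continuous g) {f : ℝ → ℂ} {x : ℝ}
    (hm : ∀ k, formalPower f k x / (x : ℂ) ^ k - 1 = ∫ s in (-1 : ℝ)..1, g s * (s : ℂ) ^ k)
    (k : ℕ) : beta f k x = legendreCoeffC g k := by
  have hmk := fun k => (hm k).trans (integral_mul_pow_eq_sum_legendreCoeffC hg k)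
  have hne : ∀ k, (legendreMoment k k : ℂ) ≠ 0 := fun k => by
    exact_mod_cast legendreMoment_self_ne_zero k
  induction k using Nat.strong_induction_on with
  | _ k ih =>
    rcases k with _ | _ | k
    · have h := hmk 0
      have h00 : legendreMoment 0 0 = 2 := by
        simp [legendreMoment, legendre_zero]
        norm_num
      simp [formalPower, recXTilde, h00] at h
      simp only [beta]
      rw [h]
      ring
    · have h := hmk 1
      have h11 : legendreMoment 1 1 = 2 / 3 := by
        have : legendre 1 = X := by
          have h2 : (C (1 / 2 : ℝ) * (2 * X) : ℝ[X]) = X := by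
            rw [← mul_assoc, ← C_ofNat, ← C_mul]
            norm_num
          rw [legendre, Function.iterate_one, pow_one, pow_one, Nat.factorial_one, Nat.cast_one,
            mul_one, derivative_sub, derivative_X_sq, derivative_one, sub_zero, h2]
        simp only [legendreMoment, this, eval_X, pow_one, ← pow_two]
        norm_num [integral_pow]
      rw [Finset.sum_range_succ, Finset.sum_range_one,
        legendreMoment_eq_zero (j := 0) (k := 1) (by norm_num), h11, pow_one] at h
      change beta f 1 x = legendreCoeffC g 1
      simp only [beta]
      rw [h]
      push_cast
      ring
    · have h := hmk (k + 2)
      rw [Finset.sum_range_succ, Finset.sum_range_succ,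
        legendreMoment_eq_zero (j := k + 1) (k := k + 2) (by omega)] at h
      simp only [beta]
      rw [Fin.sum_univ_eq_sum_range (fun j => if j % 2 = k % 2 then
        (legendreMoment j (k + 2) : ℂ) * beta f j x else 0) (k + 1), h]
      have h2 : ∑ j ∈ Finset.range (k + 1), (if j % 2 = k % 2 then
          (legendreMoment j (k + 2) : ℂ) * beta f j x else 0) =
          ∑ j ∈ Finset.range (k + 1), (legendreMoment j (k + 2) : ℂ) * legendreCoeffC g j := by
        refine Finset.sum_congr rfl fun j hj => ?_
        split_ifs with hp
        · rw [ih j (by have := Finset.mem_range.1 hj; omega)]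
        · rw [legendreMoment_eq_zero (by omega)]
          simp
      rw [h2]
      field_simp [hne (k + 2)]
      push_cast
      ring

end

/-- The scaled kernel `s ↦ x K(x, x s)` on `[-1, 1]`, extended to a `C¹` function `g` on the line,
has the moments `φ_k(x) / x ^ k - 1`. -/
lemma IsTransmutationKernel.exists_scaled_kernel {b : ℝ} {q f : ℝ → ℂ} {K : ℝ → ℝ → ℂ} (hb : 0 < b)
    (hf : IsSolution b q f) (hf0 : f 0 = 1) (hfne : ∀ x ∈ Icc 0 b, f x ≠ 0)
    (hK : IsTransmutationKernel b q f K) {x : ℝ} (hx : x ∈ Ioc 0 b) :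
    ∃ g g' : ℝ → ℂ, (∀ s, HasDerivAt g (g' s) s) ∧ Continuous g' ∧
      (∀ s ∈ Icc (-1 : ℝ) 1, g s = (x : ℂ) * K x (x * s)) ∧
      ∀ k, formalPower f k x / (x : ℂ) ^ k - 1 = ∫ s in (-1 : ℝ)..1, g s * (s : ℂ) ^ k := by
  have hx0 : (x : ℂ) ≠ 0 := by exact_mod_cast hx.1.ne'
  have hmaps : ∀ s ∈ Icc (-1 : ℝ) 1, x * s ∈ Icc (-b) b := fun s hs => by
    refine abs_le.1 ?_
    rw [abs_mul, abs_of_pos hx.1]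
    exact (mul_le_of_le_one_right hx.1.le (abs_le.2 hs)).trans hx.2
  have hC : ContDiffOn ℝ 1 (fun s : ℝ => (x : ℂ) * K x (x * s)) (Icc (-1) 1) := by
    refine contDiffOn_const.mul (hK.contDiffOn.comp (g := uncurry K) (f := fun s : ℝ => (x, x * s))
      (by fun_prop) fun s hs => ⟨⟨by linarith [hx.1], hx.2⟩, hmaps s hs⟩)
  obtain ⟨g, g', hg', hd, he⟩ := exists_hasDerivAt_extension (by norm_num) hC
  refine ⟨g, g', hd, hg', fun s hs => (he hs).symm, fun k => ?_⟩
  rw [← hK.volterraOp_pow_eq_formalPower hb hf hf0 hfne k ⟨hx.1.le, hx.2⟩, volterraOp, add_div,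
    div_self (pow_ne_zero k hx0), add_sub_cancel_left]
  have h := intervalIntegral.smul_integral_comp_mul_left (a := -1) (b := 1)
    (fun t => K x t * (t : ℂ) ^ k) x
  rw [mul_neg_one, mul_one] at h
  rw [← h, Complex.real_smul, ← intervalIntegral.integral_const_mul,
    ← intervalIntegral.integral_div]
  refine intervalIntegral.integral_congr fun s hs => ?_
  rw [uIcc_of_le (by norm_num)] at hs
  simp only [← he hs]
  push_cast
  rw [mul_pow]
  field_simp

end

end Transmutation

theorem mainTheorem2 (b : ℝ) (hb : 0 < b) (q : ℝ → ℂ)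
    (hq : ContinuousOn q (Set.Icc (-b) b)) (f : ℝ → ℂ)
    (hf : Transmutation.IsSolution b q f) (hf0 : f 0 = 1)
    (hfne : ∀ x ∈ Set.Icc 0 b, f x ≠ 0) :
    (∃ K : ℝ → ℝ → ℂ, Transmutation.IsTransmutationKernel b q f K) ∧
    (∀ K : ℝ → ℝ → ℂ, Transmutation.IsTransmutationKernel b q f K →
      ∀ x ∈ Set.Ioc 0 b,
        TendstoUniformlyOn
          (fun (N : ℕ) (t : ℝ) => ∑ j ∈ Finset.range N,
            Transmutation.beta f j x / (x : ℂ) *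
              (((Transmutation.legendre j).eval (t / x) : ℝ) : ℂ))
          (fun t => K x t) Filter.atTop (Set.Icc (-x) x)) ∧
    (∀ n : ℕ, ∀ x ∈ Set.Ioc 0 b,
      Transmutation.beta f n x = (2 * (n : ℂ) + 1) / 2 *
        ((∑ k ∈ Finset.range (n + 1),
          (((Transmutation.legendre n).coeff k : ℝ) : ℂ) *
            Transmutation.formalPower f k x / (x : ℂ) ^ k) - 1)) := by
  have hex := Transmutation.exists_isTransmutationKernel hb hq hf hf0
  refine ⟨hex, fun K hK x hx => ?_, fun n x hx => ?_⟩
  · obtain ⟨g, g', hd, hc, hgK, hm⟩ := hK.exists_scaled_kernel hb hf hf0 hfne hx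
    have hg : Continuous g := continuous_iff_continuousAt.2 fun x => (hd x).continuousAt
    have hx0 : (x : ℂ) ≠ 0 := by exact_mod_cast hx.1.ne'
    have hu := Transmutation.tendstoUniformlyOn_sum_legendreCoeffC hd hc
    rw [Metric.tendstoUniformlyOn_iff] at hu ⊢
    intro ε hε
    filter_upwards [hu (ε * x) (mul_pos hε hx.1)] with N hN t ht
    have hs : t / x ∈ Set.Icc (-1 : ℝ) 1 := by
      constructor
      · rw [le_div_iff₀ hx.1]
        linarith [ht.1]
      · rw [div_le_iff₀ hx.1]
        linarith [ht.2]
    have h1 := hN _ hs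
    rw [hgK _ hs, mul_div_cancel₀ _ hx.1.ne'] at h1
    have h2 : (x : ℂ) * K x t - ∑ j ∈ Finset.range N, Transmutation.legendreCoeffC g j *
        (((Transmutation.legendre j).eval (t / x) : ℝ) : ℂ) =
        (K x t - ∑ j ∈ Finset.range N, Transmutation.beta f j x / (x : ℂ) *
          (((Transmutation.legendre j).eval (t / x) : ℝ) : ℂ)) * x := by
      rw [sub_mul, Finset.sum_mul, mul_comm]
      congr 1
      refine Finset.sum_congr rfl fun j _ => ?_
      rw [Transmutation.beta_eq_legendreCoeffC hg hm]
      field_simp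
    rw [dist_eq_norm, h2, norm_mul, Complex.norm_real, Real.norm_eq_abs, abs_of_pos hx.1] at h1
    rw [dist_eq_norm]
    exact lt_of_mul_lt_mul_right h1 hx.1.le
  · obtain ⟨K, hK⟩ := hex
    obtain ⟨g, g', hd, hc, hgK, hm⟩ := hK.exists_scaled_kernel hb hf hf0 hfne hx
    have hg : Continuous g := continuous_iff_continuousAt.2 fun x => (hd x).continuousAt
    rw [Transmutation.beta_eq_legendreCoeffC hg hm,
      Transmutation.legendreCoeffC_eq_sum_moments hg]
    have h1 : ∑ k ∈ Finset.range (n + 1), (((Transmutation.legendre n).coeff k : ℝ) : ℂ) = 1 := by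
      have := Transmutation.legendre_eval_one n
      rw [Polynomial.eval_eq_sum_range' (Nat.lt_succ_of_le
        (Transmutation.natDegree_legendre_le n))] at this
      simp only [one_pow, mul_one] at this
      exact_mod_cast this
    congr 1
    conv_rhs => rw [← h1, ← Finset.sum_sub_distrib]
    refine Finset.sum_congr rfl fun k _ => ?_
    rw [← hm k]
    ring
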